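/- Let $d\ge 1$, let $B_1$ be the open unit ball of $\mathbb{R}^d$ centred at the origin, let $p\ge 2$ and $C\in\mathbb{R}$, and let $p'$ be given by $\frac1p+\frac1{p'}=1$. For $\phi$ of class $C^2$ near a point, write $\Delta_p\phi=|\nabla\phi|^{p-2}\Delta\phi+(p-2)|\nabla\phi|^{p-4}\langle D^2\phi\,\nabla\phi,\nabla\phi\rangle$, where the second summand is read as $0$ if $\nabla\phi=0$, and $|\nabla\phi|^{0}=1$ if $p=2$. Let $u\in C^0(B_1)$ satisfy $|\Delta_p u|\le C$ in $B_1$ in the viscosity sense: whenever a function $\phi$ that is $C^2$ near $Y\in B_1$ touches the graph of $u$ at $Y$ from below (that is, $\phi(Y)=u(Y)$ and $\phi\le u$ near $Y$), then $\Delta_p\phi(Y)\le C$; and whenever such a $\phi$ touches the graph of $u$ at $Y$ from above, then $\Delta_p\phi(Y)\ge -C$. Call $u$ smooth up to a possible radial singularity at $X_0\in B_1$ if, for all $X$ in some ball centred at $X_0$, $u(X)=\varphi(X)+\psi(|X-X_0|)$ with a function $\varphi$ of class $C^2$ in that ball such that $\varphi(X)=O(|X-X_0|^2)$ as $X\to X_0$,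 and some function $\psi$ of one variable. For an open set $U$, $u\in C^{p'}_{\rm loc}(U)=C^{1,1/(p-1)}_{\rm loc}(U)$ means that $u$ is continuously differentiable in $U$ and that $\nabla u$ is Hölder continuous with exponent $\frac1{p-1}=p'-1$ on every compact subset of $U$. Then: 1. if $u$ is smooth up to a possible radial singularity at a point $X_0\in B_1$, then $u\in C^{p'}_{\rm loc}(B_r(X_0))$ for some ball $B_r(X_0)\subset B_1$, $r>0$; 2. if every point of $B_1$ either has a neighbourhood in which $u$ is of class $C^2$ or is a point at which $u$ is smooth up to a possible radial singularity, then $u\in C^{p'}_{\rm loc}(B_1)$. -/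

import Mathlib

noncomputable section

/-- The infinity-Laplacian `Δ_∞ φ = ∑ i j, φ_i φ_j φ_ij = ⟨D²φ ∇φ, ∇φ⟩`. -/
def inftyLaplacian {d : ℕ} (φ : EuclideanSpace ℝ (Fin d) → ℝ) (x : EuclideanSpace ℝ (Fin d)) : ℝ :=
  fderiv ℝ (fderiv ℝ φ) x (gradient φ x) (gradient φ x)

/-- The `p`-Laplacian of a `C²` function, in non-divergence form
`|∇φ|^(p-2) Δφ + (p-2) |∇φ|^(p-4) Δ_∞ φ`. For `p ≥ 2` this expression is continuous in
`(∇φ, D²φ)`: where `∇φ = 0` the second summand is `0`, and the first one is `0` if `p > 2` and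
`Δφ` if `p = 2`. -/
def pLaplacian {d : ℕ} (p : ℝ) (φ : EuclideanSpace ℝ (Fin d) → ℝ)
    (x : EuclideanSpace ℝ (Fin d)) : ℝ :=
  ‖gradient φ x‖ ^ (p - 2) * Laplacian.laplacian φ x
    + (p - 2) * ‖gradient φ x‖ ^ (p - 4) * inftyLaplacian φ x

/-- `φ` touches the graph of `u` from below at `Y`. -/
def TouchesFromBelow {d : ℕ} (φ u : EuclideanSpace ℝ (Fin d) → ℝ)
    (Y : EuclideanSpace ℝ (Fin d)) : Prop :=
  φ Y = u Y ∧ ∀ᶠ X in nhds Y, φ X ≤ u X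

/-- `φ` touches the graph of `u` from above at `Y`. -/
def TouchesFromAbove {d : ℕ} (φ u : EuclideanSpace ℝ (Fin d) → ℝ)
    (Y : EuclideanSpace ℝ (Fin d)) : Prop :=
  φ Y = u Y ∧ ∀ᶠ X in nhds Y, u X ≤ φ X

/-- `|Δ_p u| ≤ C` in the open set `U` in the viscosity sense: `u` is continuous in `U`, it is a
viscosity super-solution of `Δ_p u = C` and a viscosity sub-solution of `Δ_p u = -C`. -/
def ViscosityPLaplacianBounded {d : ℕ} (p C : ℝ) (u : EuclideanSpace ℝ (Fin d) → ℝ)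
    (U : Set (EuclideanSpace ℝ (Fin d))) : Prop :=
  ContinuousOn u U ∧
  (∀ Y ∈ U, ∀ φ : EuclideanSpace ℝ (Fin d) → ℝ, ContDiffAt ℝ 2 φ Y →
    TouchesFromBelow φ u Y → pLaplacian p φ Y ≤ C) ∧
  (∀ Y ∈ U, ∀ φ : EuclideanSpace ℝ (Fin d) → ℝ, ContDiffAt ℝ 2 φ Y →
    TouchesFromAbove φ u Y → -C ≤ pLaplacian p φ Y)

/-- `u` is smooth up to a possible radial singularity at `X₀`: near `X₀` one can write
`u(X) = φ(X) + ψ(|X - X₀|)` with `φ` of class `C²` and `φ(X) = O(|X - X₀|²)`. -/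
def SmoothUpToRadialSingularityAt {d : ℕ} (u : EuclideanSpace ℝ (Fin d) → ℝ)
    (X₀ : EuclideanSpace ℝ (Fin d)) : Prop :=
  ∃ r : ℝ, 0 < r ∧ ∃ (φ : EuclideanSpace ℝ (Fin d) → ℝ) (ψ : ℝ → ℝ),
    ContDiffOn ℝ 2 φ (Metric.ball X₀ r) ∧
    φ =O[nhds X₀] (fun X => ‖X - X₀‖ ^ 2) ∧
    ∀ X ∈ Metric.ball X₀ r, u X = φ X + ψ ‖X - X₀‖

/-- `u ∈ C^{1,α}_loc(U)` for an open set `U`: `u` is continuously differentiable in `U` and its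
gradient is Hölder continuous with exponent `α` on every compact subset of `U`. -/
def IsC1HolderLoc {d : ℕ} (α : ℝ) (u : EuclideanSpace ℝ (Fin d) → ℝ)
    (U : Set (EuclideanSpace ℝ (Fin d))) : Prop :=
  ContDiffOn ℝ 1 u U ∧
  ∀ K ⊆ U, IsCompact K → ∃ L : ℝ, ∀ x ∈ K, ∀ y ∈ K,
    ‖gradient u x - gradient u y‖ ≤ L * ‖x - y‖ ^ α

end

open Filter Topology Metric
open scoped RealInnerProductSpace

/-! All roughness of `u` sits in `ψ`, so the problem is one-dimensional: it suffices to control `u`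
along a single ray from `X₀`. Write α = 1/(p-1). This exponent is the scaling of the equation:
gradient of size ρ^α and second derivative of size ρ^(α-1) give Δ_p of size ρ^(α(p-1)-1) = 1.

Each estimate is a contradiction of this kind. If it fails with a large constant, a C² function
touches `u` from below with gradient at least about ρ^α and with second derivative in one direction
so large that it outweighs D²φ and the tangential curvature of spheres; then Δ_p of the test
function exceeds `C` (`le_pLaplacian`, `test_below`). Replacing `u` by `-u` gives the opposite
inequality. Since the operator degenerates where the gradient vanishes, each test function must have
its gradient bounded away from zero, and this dictates the constructions.

Three such estimates carry the proof. `radial_growth`: `ψ` departs from `ψ 0` by at most a multiple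
of ρ^(1+α). `slope_le`: chords of `u` along a ray, at distance c from the centre, have slope O(c^α).
`slope_sub_slope_le`: slopes of adjacent chords on an interval of length l differ by O(l^α). The
last two rest on `kink_test`: a jump of slope lets a parabola with large opening touch along the
ray, and the radial structure turns it into a test function in space.

Close slopes make `ψ` differentiable with α-Hölder derivative that is O(t^α) at 0, so the radial
field ∇(ψ(|X - X₀|)) is α-Hölder across the centre. C² functions are locally C^{1,α} since α ≤ 1,
and compactness of K × K passes from local to compact-set bounds. -/

/-! ### The Hessian test and the symmetry under change of sign -/

/-- A lower bound of the `p`-Laplacian by a rank-one lower bound of the Hessian. -/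
theorem le_pLaplacian {d : ℕ} {p N lam : ℝ} (hp : 2 ≤ p) (hN : 0 ≤ N)
    {f : EuclideanSpace ℝ (Fin d) → ℝ} {x e : EuclideanSpace ℝ (Fin d)} (he : ‖e‖ = 1)
    (hH : ∀ v, N * ⟪e, v⟫ ^ 2 - lam * ‖v‖ ^ 2 ≤ fderiv ℝ (fderiv ℝ f) x v v)
    (hG : gradient f x ≠ 0) :
    ‖gradient f x‖ ^ (p - 2) * (N - (d + p - 2) * lam) ≤ pLaplacian p f x := by
  have hG0 : 0 < ‖gradient f x‖ := norm_pos_iff.2 hG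
  have h1 : N - d * lam ≤ Laplacian.laplacian f x := by
    rw [InnerProductSpace.laplacian_eq_iteratedFDeriv_orthonormalBasis f
      (EuclideanSpace.basisFun (Fin d) ℝ)]
    have hb := (EuclideanSpace.basisFun (Fin d) ℝ).sum_sq_norm_inner_left e
    have : N - d * lam = ∑ i, (N * ⟪e, EuclideanSpace.basisFun (Fin d) ℝ i⟫ ^ 2 - lam *
        ‖EuclideanSpace.basisFun (Fin d) ℝ i‖ ^ 2) := by
      simp only [OrthonormalBasis.norm_eq_one, Finset.sum_sub_distrib, ← Finset.mul_sum]
      simp only [Real.norm_eq_abs, sq_abs, he] at hb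
      rw [hb]
      simp
      ring
    rw [this]
    refine Finset.sum_le_sum fun i _ => ?_
    rw [iteratedFDeriv_two_apply]
    exact hH _
  have h2 : -(lam * ‖gradient f x‖ ^ 2) ≤ inftyLaplacian f x := by
    refine le_trans ?_ (hH (gradient f x))
    have := mul_nonneg hN (sq_nonneg ⟪e, gradient f x⟫)
    linarith
  -- The exponent p - 4 may be negative, so this splitting needs the gradient to be nonzero.
  have h3 : ‖gradient f x‖ ^ (p - 2) = ‖gradient f x‖ ^ (p - 4) * ‖gradient f x‖ ^ 2 := by
    rw [← Real.rpow_natCast, ← Real.rpow_add hG0]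
    congr 1
    push_cast
    ring
  have h4 : 0 ≤ ‖gradient f x‖ ^ (p - 2) := by positivity
  have h5 : 0 ≤ (p - 2) * ‖gradient f x‖ ^ (p - 4) :=
    mul_nonneg (by linarith) (by positivity)
  unfold pLaplacian
  calc ‖gradient f x‖ ^ (p - 2) * (N - (d + p - 2) * lam)
      = ‖gradient f x‖ ^ (p - 2) * (N - d * lam)
        + (p - 2) * ‖gradient f x‖ ^ (p - 4) * (-(lam * ‖gradient f x‖ ^ 2)) := by
        rw [h3]; ring
    _ ≤ _ := add_le_add (mul_le_mul_of_nonneg_left h1 h4) (mul_le_mul_of_nonneg_left h2 h5)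

theorem gradient_neg_apply {d : ℕ} (f : EuclideanSpace ℝ (Fin d) → ℝ)
    (x : EuclideanSpace ℝ (Fin d)) : gradient (-f) x = -gradient f x := by
  simp [gradient, fderiv_neg]

theorem fderiv_fderiv_neg {E : Type*} [NormedAddCommGroup E] [NormedSpace ℝ E] (f : E → ℝ) (x : E) :
    fderiv ℝ (fderiv ℝ (-f)) x = -fderiv ℝ (fderiv ℝ f) x := by
  have : fderiv ℝ (-f) = -fderiv ℝ f := by
    ext1 y
    simp [fderiv_neg]
  rw [this, fderiv_neg]

theorem pLaplacian_neg {d : ℕ} (p : ℝ) (f : EuclideanSpace ℝ (Fin d) → ℝ)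
    (x : EuclideanSpace ℝ (Fin d)) : pLaplacian p (-f) x = -pLaplacian p f x := by
  have h1 : Laplacian.laplacian (-f) x = -Laplacian.laplacian f x := by
    simp only [InnerProductSpace.laplacian_eq_iteratedFDeriv_stdOrthonormalBasis,
      iteratedFDeriv_two_apply, fderiv_fderiv_neg]
    simp
  have h2 : inftyLaplacian (-f) x = -inftyLaplacian f x := by
    simp [inftyLaplacian, fderiv_fderiv_neg, gradient_neg_apply]
  rw [pLaplacian, pLaplacian, h1, h2, gradient_neg_apply, norm_neg]
  ring

/-! ### Normalised radial perturbations -/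

/-- `u` is, in the ball of radius `r` around `X₀`, a radial perturbation of a `C²` function `φ`
with bounds on its first two derivatives, and satisfies `|Δ_p u| ≤ C` in the viscosity sense. -/
structure RadialPerturbation {d : ℕ} (p C M r : ℝ) (u φ : EuclideanSpace ℝ (Fin d) → ℝ)
    (ψ : ℝ → ℝ) (X₀ : EuclideanSpace ℝ (Fin d)) : Prop where
  two_le : 2 ≤ p
  C_nonneg : 0 ≤ C
  M_nonneg : 0 ≤ M
  r_pos : 0 < r
  r_le : r ≤ 1
  contDiffOn : ContDiffOn ℝ 2 φ (ball X₀ r)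
  map_center : φ X₀ = 0
  fderiv_le : ∀ x ∈ ball X₀ r, ‖fderiv ℝ φ x‖ ≤ M * ‖x - X₀‖
  hess_le : ∀ x ∈ ball X₀ r, ‖fderiv ℝ (fderiv ℝ φ) x‖ ≤ M
  eq : ∀ x ∈ ball X₀ r, u x = φ x + ψ ‖x - X₀‖
  continuousOn : ContinuousOn u (ball X₀ r)
  below : ∀ Y ∈ ball X₀ r, ∀ f : EuclideanSpace ℝ (Fin d) → ℝ, ContDiffAt ℝ 2 f Y →
    TouchesFromBelow f u Y → pLaplacian p f Y ≤ C
  above : ∀ Y ∈ ball X₀ r, ∀ f : EuclideanSpace ℝ (Fin d) → ℝ, ContDiffAt ℝ 2 f Y →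
    TouchesFromAbove f u Y → -C ≤ pLaplacian p f Y

namespace RadialPerturbation

variable {d : ℕ} {p C M r : ℝ} {u φ : EuclideanSpace ℝ (Fin d) → ℝ} {ψ : ℝ → ℝ}
  {X₀ : EuclideanSpace ℝ (Fin d)}

/-- Touching from above becomes touching from below, because the operator is odd. Hence every
one-sided estimate below is automatically two-sided. -/
theorem neg (h : RadialPerturbation p C M r u φ ψ X₀) :
    RadialPerturbation p C M r (-u) (-φ) (-ψ) X₀ where
  two_le := h.two_le
  C_nonneg := h.C_nonneg
  M_nonneg := h.M_nonneg
  r_pos := h.r_pos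
  r_le := h.r_le
  contDiffOn := h.contDiffOn.neg
  map_center := by simp [h.map_center]
  fderiv_le x hx := by simpa [fderiv_neg] using h.fderiv_le x hx
  hess_le x hx := by
    rw [fderiv_fderiv_neg]
    rw [ContinuousLinearMap.opNorm_neg]
    exact h.hess_le x hx
  eq x hx := by simp [h.eq x hx]; ring
  continuousOn := h.continuousOn.neg
  below Y hY f hf ht := by
    have := h.above Y hY (-f) hf.neg ⟨by simp [ht.1], by
      filter_upwards [ht.2] with x hx
      simp only [Pi.neg_apply] at *
      linarith⟩
    rw [pLaplacian_neg] at this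
    linarith
  above Y hY f hf ht := by
    have := h.below Y hY (-f) hf.neg ⟨by simp [ht.1], by
      filter_upwards [ht.2] with x hx
      simp only [Pi.neg_apply] at *
      linarith⟩
    rw [pLaplacian_neg] at this
    linarith

theorem contDiffAt (h : RadialPerturbation p C M r u φ ψ X₀) {x : EuclideanSpace ℝ (Fin d)}
    (hx : x ∈ ball X₀ r) : ContDiffAt ℝ 2 φ x :=
  h.contDiffOn.contDiffAt (isOpen_ball.mem_nhds hx)

theorem hasFDerivAt (h : RadialPerturbation p C M r u φ ψ X₀) {x : EuclideanSpace ℝ (Fin d)}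
    (hx : x ∈ ball X₀ r) : HasFDerivAt φ (fderiv ℝ φ x) x :=
  ((h.contDiffAt hx).differentiableAt (by norm_num)).hasFDerivAt

theorem hasFDerivAt_fderiv (h : RadialPerturbation p C M r u φ ψ X₀)
    {x : EuclideanSpace ℝ (Fin d)} (hx : x ∈ ball X₀ r) :
    HasFDerivAt (fderiv ℝ φ) (fderiv ℝ (fderiv ℝ φ) x) x :=
  (((h.contDiffAt hx).fderiv_right (m := 1) (by norm_num)).differentiableAt
    (by norm_num)).hasFDerivAt

theorem hess_apply_le (h : RadialPerturbation p C M r u φ ψ X₀) {x : EuclideanSpace ℝ (Fin d)}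
    (hx : x ∈ ball X₀ r) (v : EuclideanSpace ℝ (Fin d)) :
    |fderiv ℝ (fderiv ℝ φ) x v v| ≤ M * ‖v‖ ^ 2 := by
  have h1 := (fderiv ℝ (fderiv ℝ φ) x v).le_opNorm v
  have h2 := (fderiv ℝ (fderiv ℝ φ) x).le_opNorm v
  rw [Real.norm_eq_abs] at h1
  calc _ ≤ _ := h1
    _ ≤ (‖fderiv ℝ (fderiv ℝ φ) x‖ * ‖v‖) * ‖v‖ := by gcongr
    _ ≤ (M * ‖v‖) * ‖v‖ := by gcongr; exact h.hess_le x hx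
    _ = _ := by ring

/-- The second-order test: a touching `C²` function with a Hessian that is large in one direction
cannot have a large gradient. -/
theorem test_below (h : RadialPerturbation p C M r u φ ψ X₀) {Y e : EuclideanSpace ℝ (Fin d)}
    (hY : Y ∈ ball X₀ r) {f : EuclideanSpace ℝ (Fin d) → ℝ} (hf : ContDiffAt ℝ 2 f Y)
    (ht : TouchesFromBelow f u Y) {N lam s : ℝ} (hN : 0 ≤ N) (he : ‖e‖ = 1)
    (hH : ∀ v, N * ⟪e, v⟫ ^ 2 - lam * ‖v‖ ^ 2 ≤ fderiv ℝ (fderiv ℝ f) Y v v)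
    (hs : 0 < s) (hG : s ≤ ‖gradient f Y‖) :
    s ^ (p - 2) * (N - (d + p - 2) * lam) ≤ C := by
  have h1 := h.below Y hY f hf ht
  have hp := h.two_le
  have h2 := le_pLaplacian hp hN he hH (norm_pos_iff.1 (hs.trans_le hG))
  rcases le_total 0 (N - (d + p - 2) * lam) with h0 | h0
  · refine le_trans ?_ (h2.trans h1)
    gcongr
  · exact (mul_nonpos_of_nonneg_of_nonpos (by positivity) h0).trans h.C_nonneg

theorem abs_apply_le (h : RadialPerturbation p C M r u φ ψ X₀) {x : EuclideanSpace ℝ (Fin d)}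
    (hx : x ∈ ball X₀ r) : |φ x| ≤ M * ‖x - X₀‖ ^ 2 := by
  have hb : closedBall X₀ ‖x - X₀‖ ⊆ ball X₀ r :=
    closedBall_subset_ball (by simpa [dist_eq_norm] using hx)
  have := (convex_closedBall X₀ ‖x - X₀‖).norm_image_sub_le_of_norm_fderiv_le (𝕜 := ℝ) (f := φ)
    (C := M * ‖x - X₀‖) (x := X₀) (y := x)
    (fun y hy => (h.hasFDerivAt (hb hy)).differentiableAt)
    (fun y hy => (h.fderiv_le y (hb hy)).trans
      (mul_le_mul_of_nonneg_left (by simpa [dist_eq_norm] using hy) h.M_nonneg))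
    (by simp) (by simp [dist_eq_norm])
  rw [h.map_center, sub_zero, Real.norm_eq_abs] at this
  linarith

end RadialPerturbation

/-! ### Growth of the radial part at the centre -/

theorem hasFDerivAt_affine_add_sq {E : Type*} [NormedAddCommGroup E] [InnerProductSpace ℝ E]
    (a x₀ : E) (n c : ℝ) (x : E) :
    HasFDerivAt (fun x => ⟪a, x - x₀⟫ + n * ‖x - x₀‖ ^ 2 + c)
      (innerSL ℝ a + (2 * n) • innerSL ℝ (x - x₀)) x := by
  have h1 : HasFDerivAt (fun x => x - x₀) (ContinuousLinearMap.id ℝ E) x :=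
    (hasFDerivAt_id x).sub_const x₀
  have h2 : HasFDerivAt (fun x => ⟪a, x - x₀⟫) (innerSL ℝ a) x := by
    exact ((innerSL ℝ a).hasFDerivAt.comp x h1).congr_fderiv (by ext v; simp)
  have h3 : HasFDerivAt (fun x => n * ‖x - x₀‖ ^ 2) ((2 * n) • innerSL ℝ (x - x₀)) x := by
    have := (h1.norm_sq).const_mul n
    refine this.congr_fderiv ?_
    ext v
    simp
    ring
  exact (h2.add h3).add_const c

theorem one_add_le_rpow {C t : ℝ} (hC : 0 ≤ C) (ht : 1 ≤ t) : 1 + C ≤ (1 + C) ^ t := by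
  simpa using Real.rpow_le_rpow_of_exponent_le (by linarith : 1 ≤ 1 + C) ht

namespace RadialPerturbation

variable {d : ℕ} {p C M r : ℝ} {u φ : EuclideanSpace ℝ (Fin d) → ℝ} {ψ : ℝ → ℝ}
  {X₀ : EuclideanSpace ℝ (Fin d)}

/-- The constant in the growth estimate of the radial part. -/
noncomputable def growthConst (d : ℕ) (p C M : ℝ) : ℝ := 8 * (1 + C + M * (d + p))

-- If `ψ ρ` exceeded `ψ 0` by more than Bρ with B = Kρ^α, then φ plus a tilted paraboloid could be
-- raised until it touches `u` from below strictly inside the ball of radius ρ. The tilt keeps the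
-- gradient away from zero even when contact occurs at the centre. Only the values of `ψ` at 0 and ρ
-- enter.
set_option maxHeartbeats 800000 in
theorem radial_growth (h : RadialPerturbation p C M r u φ ψ X₀)
    {e : EuclideanSpace ℝ (Fin d)} (he : ‖e‖ = 1) {ρ : ℝ} (hρ : 0 < ρ) (hρr : ρ < r) :
    ψ ρ - ψ 0 ≤ growthConst d p C M * ρ ^ (1 + 1 / (p - 1)) := by
  by_contra! hlt
  have hp := h.two_le
  have hC := h.C_nonneg
  have hM := h.M_nonneg
  have hρ1 : ρ < 1 := hρr.trans_le h.r_le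
  set K := growthConst d p C M with hKdef
  set α := 1 / (p - 1) with hα
  have hα0 : 0 < α := by rw [hα]; apply one_div_pos.2; linarith
  have hα1 : α ≤ 1 := by rw [hα, div_le_one (by linarith)]; linarith
  have hαp : α * (p - 1) = 1 := by rw [hα]; field_simp [show p - 1 ≠ 0 by linarith]
  have hMd : 0 ≤ M * (d + p) := mul_nonneg hM (by positivity)
  have hK8 : 8 * (1 + C) ≤ K := by rw [hKdef, growthConst]; linarith
  have hKM : 8 * (M * (d + p)) ≤ K := by rw [hKdef, growthConst]; linarith
  have hK0 : 0 < K := by linarith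
  set B := K * ρ ^ α with hB
  have hρα : 0 < ρ ^ α := by positivity
  have hραle : ρ ≤ ρ ^ α := by
    simpa using Real.rpow_le_rpow_of_exponent_ge hρ hρ1.le hα1
  have hB0 : 0 < B := by positivity
  have hBK : K * ρ ≤ B := mul_le_mul_of_nonneg_left hραle hK0.le
  have hBρ : K * ρ ^ (1 + α) = B * ρ := by rw [Real.rpow_add hρ, Real.rpow_one]; ring
  rw [hBρ] at hlt
  set n := B / (8 * ρ) with hn
  have hnρ : n * ρ = B / 8 := by rw [hn]; field_simp
  have hn0 : 0 < n := by positivity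
  -- The tilt B/2 has to dominate the other two gradient terms: 2nρ = B/4 from the paraboloid and Mρ
  -- ≤ B/8 from φ. This leaves B/8.
  set a := (B / 2) • e with ha
  have hanorm : ‖a‖ = B / 2 := by rw [ha, norm_smul, he, Real.norm_of_nonneg (by positivity), mul_one]
  have hcb : closedBall X₀ ρ ⊆ ball X₀ r := closedBall_subset_ball hρr
  set g : EuclideanSpace ℝ (Fin d) → ℝ := fun x => ⟪a, x - X₀⟫ + n * ‖x - X₀‖ ^ 2 with hg
  obtain ⟨Y, hYmem, hYmin⟩ := (isCompact_closedBall X₀ ρ).exists_isMinOn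
    ⟨X₀, mem_closedBall_self hρ.le⟩ (f := fun x => u x - (φ x + g x))
    (((h.continuousOn.mono hcb).sub ((h.contDiffOn.continuousOn.mono hcb).add
      (by fun_prop))))
  have hYb := hcb hYmem
  have hY0 : u Y - (φ Y + g Y) ≤ ψ 0 := by
    have := hYmin (mem_closedBall_self hρ.le : X₀ ∈ closedBall X₀ ρ)
    simp only [Set.mem_ofPred_eq] at this
    refine this.trans (le_of_eq ?_)
    rw [h.eq X₀ (mem_ball_self h.r_pos)]
    simp [hg]
  have hYle : ‖Y - X₀‖ ≤ ρ := by simpa [dist_eq_norm] using hYmem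
  -- On the sphere of radius ρ the paraboloid is at most (1/2 + 1/8)Bρ, less than the assumed gap
  -- Bρ.
  have hYlt : ‖Y - X₀‖ < ρ := by
    refine lt_of_le_of_ne hYle fun heq => ?_
    rw [h.eq Y hYb, heq] at hY0
    have h1 : ⟪a, Y - X₀⟫ ≤ B / 2 * ρ := by
      rw [← hanorm, ← heq]; exact real_inner_le_norm _ _
    have h2 : g Y ≤ B / 2 * ρ + (B / 8) * ρ := by
      simp only [hg, heq]
      rw [pow_two, ← mul_assoc, hnρ]
      linarith
    nlinarith
  have hball : ball X₀ ρ ∈ 𝓝 Y := isOpen_ball.mem_nhds (by simpa [dist_eq_norm] using hYlt)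
  set c := u Y - (φ Y + g Y) with hc
  set q : EuclideanSpace ℝ (Fin d) → ℝ := fun x => ⟪a, x - X₀⟫ + n * ‖x - X₀‖ ^ 2 + c with hq
  set f : EuclideanSpace ℝ (Fin d) → ℝ := fun x => φ x + q x with hf
  have hft : TouchesFromBelow f u Y := by
    refine ⟨by simp only [hf, hq, hc, hg]; ring, ?_⟩
    filter_upwards [hball] with x hx
    have := hYmin (ball_subset_closedBall hx)
    simp only [Set.mem_ofPred_eq] at this
    simp only [hf, hq, hg, hc] at this ⊢
    linarith
  have hfd : ∀ x ∈ ball X₀ r, fderiv ℝ f x =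
      fderiv ℝ φ x + (innerSL ℝ a + (2 * n) • innerSL ℝ (x - X₀)) := fun x hx =>
    ((h.hasFDerivAt hx).add (hasFDerivAt_affine_add_sq a X₀ n c x)).fderiv
  have hfdd : ∀ v, fderiv ℝ (fderiv ℝ f) Y v v =
      fderiv ℝ (fderiv ℝ φ) Y v v + 2 * n * ‖v‖ ^ 2 := by
    intro v
    have h1 : fderiv ℝ f =ᶠ[𝓝 Y] fun x =>
        fderiv ℝ φ x + (innerSL ℝ a + (2 * n) • innerSL ℝ (x - X₀)) :=
      Filter.eventuallyEq_of_mem (isOpen_ball.mem_nhds hYb) hfd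
    have h2 : HasFDerivAt (fun x => innerSL ℝ a + (2 * n) • innerSL ℝ (x - X₀))
        ((2 * n) • (innerSL ℝ (E := EuclideanSpace ℝ (Fin d)))) Y := by
      have := ((innerSL ℝ (E := EuclideanSpace ℝ (Fin d))).hasFDerivAt.comp Y
        ((hasFDerivAt_id Y).sub_const X₀))
      exact ((this.const_smul (2 * n)).const_add _)
    rw [h1.fderiv_eq]
    refine (congrArg (fun L => L v v) ((h.hasFDerivAt_fderiv hYb).add h2).fderiv).trans ?_
    simp only [add_apply, smul_apply, smul_eq_mul]
    congr 2
    exact real_inner_self_eq_norm_sq v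
  have hfc : ContDiffAt ℝ 2 f Y := by
    refine (h.contDiffAt hYb).add ?_
    have : ContDiff ℝ 2 q := by
      simp only [hq]
      exact ((contDiff_const.inner ℝ (contDiff_id.sub contDiff_const)).add
        (contDiff_const.mul ((contDiff_id.sub contDiff_const).norm_sq ℝ))).add contDiff_const
    exact this.contDiffAt
  have hG : B / 8 ≤ ‖gradient f Y‖ := by
    have h1 : ‖gradient f Y‖ = ‖fderiv ℝ f Y‖ := by simp [gradient]
    rw [h1, hfd Y hYb]
    have h2 : ‖innerSL ℝ a‖ = B / 2 := by rw [innerSL_apply_norm, hanorm]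
    have h3 : ‖(2 * n) • innerSL ℝ (Y - X₀)‖ ≤ B / 4 := by
      rw [norm_smul, innerSL_apply_norm, Real.norm_of_nonneg (by positivity)]
      nlinarith
    have h4 : ‖fderiv ℝ φ Y‖ ≤ B / 8 := by
      refine (h.fderiv_le Y hYb).trans ?_
      have : M * ‖Y - X₀‖ ≤ M * ρ := mul_le_mul_of_nonneg_left hYle hM
      have : M * ρ ≤ K / 8 * ρ := by
        apply mul_le_mul_of_nonneg_right _ hρ.le
        have : M * 1 ≤ M * (d + p) := mul_le_mul_of_nonneg_left
          (by have : (0 : ℝ) ≤ d := by positivity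
              linarith) hM
        linarith
      linarith
    have h5 := norm_sub_le (fderiv ℝ φ Y + (innerSL ℝ a + (2 * n) • innerSL ℝ (Y - X₀)))
      (fderiv ℝ φ Y + (2 * n) • innerSL ℝ (Y - X₀))
    have h6 := norm_add_le (fderiv ℝ φ Y) ((2 * n) • innerSL ℝ (Y - X₀))
    have h7 : fderiv ℝ φ Y + (innerSL ℝ a + (2 * n) • innerSL ℝ (Y - X₀)) -
      (fderiv ℝ φ Y + (2 * n) • innerSL ℝ (Y - X₀)) = innerSL ℝ a := by abel
    rw [h7, h2] at h5
    linarith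
  have key := h.test_below hYb hfc hft (N := 2 * n) (lam := M) (s := B / 8) (by positivity) he
    (fun v => by
      rw [hfdd]
      have h1 := abs_le.1 (h.hess_apply_le hYb v)
      have h2 : ⟪e, v⟫ ^ 2 ≤ ‖v‖ ^ 2 := by
        rw [sq_le_sq, abs_norm]
        simpa [he] using abs_real_inner_le_norm e v
      have h3 : 2 * n * ⟪e, v⟫ ^ 2 ≤ 2 * n * ‖v‖ ^ 2 :=
        mul_le_mul_of_nonneg_left h2 (by positivity)
      linarith [h1.1]) (by positivity) hG
  -- The summand M(d + p) of the growth constant, together with ρ ≤ ρ^α, lets half of the opening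
  -- absorb the contribution of D²φ.
  have hnn : n ≤ 2 * n - (d + p - 2) * M := by
    have : M * (d + p) ≤ n := by
      rw [hn, le_div_iff₀ (by positivity)]
      have := mul_le_mul_of_nonneg_right hKM hρ.le
      linarith
    have h0 : (d + p - 2) * M = M * (d + p) - 2 * M := by ring
    linarith
  have h1 : (B / 8) ^ (p - 2) * n ≤ C :=
    (mul_le_mul_of_nonneg_left hnn (by positivity)).trans key
  -- The powers of ρ cancel because α(p - 1) = 1.
  have h2 : (B / 8) ^ (p - 2) * n = (K / 8) ^ (p - 1) := by
    have e1 : n = B / 8 / ρ := by rw [hn]; field_simp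
    have e2 : (B / 8) ^ (p - 1) = (B / 8) ^ (p - 2) * (B / 8) := by
      rw [← Real.rpow_add_one (by positivity)]
      ring_nf
    have e3 : (B / 8) ^ (p - 1) = (K / 8) ^ (p - 1) * ρ := by
      rw [show B / 8 = K / 8 * ρ ^ α by rw [hB]; ring,
        Real.mul_rpow (by positivity) (by positivity), ← Real.rpow_mul hρ.le, hαp, Real.rpow_one]
    rw [e1, ← mul_div_assoc, ← e2, e3]
    field_simp
  have h3 : 1 + C ≤ (K / 8) ^ (p - 1) :=
    (one_add_le_rpow hC (by linarith)).trans
      (Real.rpow_le_rpow (by linarith) (by linarith) (by linarith))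
  linarith

theorem abs_radial_growth (h : RadialPerturbation p C M r u φ ψ X₀)
    {e : EuclideanSpace ℝ (Fin d)} (he : ‖e‖ = 1) {ρ : ℝ} (hρ : 0 < ρ) (hρr : ρ < r) :
    |ψ ρ - ψ 0| ≤ growthConst d p C M * ρ ^ (1 + 1 / (p - 1)) := by
  have h1 := h.radial_growth he hρ hρr
  have h2 := h.neg.radial_growth he hρ hρr
  simp only [Pi.neg_apply] at h2
  exact abs_le.2 ⟨by linarith, h1⟩

end RadialPerturbation

/-! ### Convex kinks and radial test functions -/

/-- At a convex kink, a continuous function is touched from below by a parabola. -/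
theorem exists_parabola_touching_below {w : ℝ → ℝ} {a b c s₁ s₂ : ℝ} (hac : a < c) (hcb : c < b)
    (hw : ContinuousOn w (Set.Icc a b)) (hs : s₁ < s₂) (h₁ : w c - w a ≤ s₁ * (c - a))
    (h₂ : s₂ * (b - c) ≤ w b - w c) :
    ∃ t ∈ Set.Ioo a b, ∃ s ∈ Set.Icc s₁ s₂, ∀ x ∈ Set.Icc a b,
      w t + s * (x - t) + (s₂ - s₁) / (b - a) / 2 * (x - t) ^ 2 ≤ w x := by
  have hab : 0 < b - a := by linarith
  -- With this opening, the slope of the comparison parabola runs from `s₁` at `a` to `s₂` at `b`.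
  -- The hypotheses on the two chords exclude a minimum of the difference at either endpoint.
  set N := (s₂ - s₁) / (b - a) with hN
  have hN0 : 0 < N := div_pos (by linarith) hab
  have hNab : N * (b - a) = s₂ - s₁ := by rw [hN]; field_simp
  obtain ⟨t, ht, hmin⟩ := isCompact_Icc.exists_isMinOn (Set.nonempty_Icc.2 (by linarith : a ≤ b))
    (f := fun x => w x - (s₁ * (x - a) + N / 2 * (x - a) ^ 2))
    (hw.sub (by fun_prop))
  have hmin' : ∀ x ∈ Set.Icc a b, w t - (s₁ * (t - a) + N / 2 * (t - a) ^ 2) ≤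
    w x - (s₁ * (x - a) + N / 2 * (x - a) ^ 2) := fun x hx => hmin hx
  have hc := hmin' c ⟨hac.le, hcb.le⟩
  have hta : t ≠ a := by
    rintro rfl
    have : 0 < N / 2 * (c - t) ^ 2 := by
      have : 0 < c - t := by linarith
      positivity
    simp only [sub_self] at hc
    linarith
  have htb : t ≠ b := by
    rintro rfl
    have h3 : 0 < N / 2 * (t - c) ^ 2 := by
      have : 0 < t - c := by linarith
      positivity
    have h4 : s₂ * (t - c) = (s₁ + N * (t - a)) * (t - c) := by rw [hNab]; ring
    nlinarith
  refine ⟨t, ⟨lt_of_le_of_ne ht.1 hta.symm, lt_of_le_of_ne ht.2 htb⟩, s₁ + N * (t - a), ⟨?_, ?_⟩, ?_⟩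
  · have := mul_nonneg hN0.le (sub_nonneg.2 ht.1)
    linarith
  · have := mul_le_mul_of_nonneg_left (sub_le_sub_right ht.2 a) hN0.le
    linarith
  · intro x hx
    have := hmin' x hx
    have e : s₁ * (x - a) + N / 2 * (x - a) ^ 2 - (s₁ * (t - a) + N / 2 * (t - a) ^ 2) =
      (s₁ + N * (t - a)) * (x - t) + N / 2 * (x - t) ^ 2 := by ring
    linarith

section norm

variable {E : Type*} [NormedAddCommGroup E] [InnerProductSpace ℝ E]

theorem hasFDerivAt_norm_sub {x x₀ : E} (hx : x ≠ x₀) :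
    HasFDerivAt (fun x => ‖x - x₀‖) (‖x - x₀‖⁻¹ • innerSL ℝ (x - x₀)) x := by
  have h0 : ‖x - x₀‖ ≠ 0 := norm_ne_zero_iff.2 (sub_ne_zero.2 hx)
  have h1 : HasFDerivAt (fun x => x - x₀) (ContinuousLinearMap.id ℝ E) x :=
    (hasFDerivAt_id x).sub_const x₀
  have h2 := h1.norm_sq.sqrt (by positivity)
  simp only [norm_nonneg, Real.sqrt_sq] at h2
  refine h2.congr_fderiv ?_
  ext v
  simp
  field_simp

theorem HasDerivAt.hasFDerivAt_comp_norm_sub {g : ℝ → ℝ} {g' : ℝ} {x x₀ : E} (hx : x ≠ x₀)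
    (hg : HasDerivAt g g' ‖x - x₀‖) :
    HasFDerivAt (fun x => g ‖x - x₀‖) ((g' / ‖x - x₀‖) • innerSL ℝ (x - x₀)) x := by
  refine (hg.comp_hasFDerivAt x (hasFDerivAt_norm_sub hx)).congr_fderiv ?_
  rw [smul_smul, div_eq_mul_inv]

/-- For k = g'/t the field is the differential of g(|x - x₀|), so this yields the Hessian of a
radial function. Only its quadratic form is needed. -/
theorem HasDerivAt.exists_hasFDerivAt_norm_sub_smul {k : ℝ → ℝ} {k' : ℝ} {x x₀ : E} (hx : x ≠ x₀)
    (hk : HasDerivAt k k' ‖x - x₀‖) :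
    ∃ L : E →L[ℝ] E →L[ℝ] ℝ, HasFDerivAt (fun x => k ‖x - x₀‖ • innerSL ℝ (x - x₀)) L x ∧
      ∀ v, L v v = k ‖x - x₀‖ * ‖v‖ ^ 2 + k' / ‖x - x₀‖ * ⟪x - x₀, v⟫ ^ 2 := by
  have h1 : HasFDerivAt (fun x => innerSL ℝ (x - x₀)) (innerSL ℝ (E := E)) x :=
    (innerSL ℝ (E := E)).hasFDerivAt.comp x ((hasFDerivAt_id x).sub_const x₀)
  refine ⟨_, (hk.hasFDerivAt_comp_norm_sub hx).smul h1, fun v => ?_⟩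
  have h2 : innerSL ℝ v v = ‖v‖ ^ 2 := real_inner_self_eq_norm_sq v
  simp only [add_apply, smul_apply, smul_eq_mul,
    ContinuousLinearMap.smulRight_apply, innerSL_apply_apply]
  congr 1
  · congr 1
  · ring

end norm

namespace RadialPerturbation

variable {d : ℕ} {p C M r : ℝ} {u φ : EuclideanSpace ℝ (Fin d) → ℝ} {ψ : ℝ → ℝ}
  {X₀ : EuclideanSpace ℝ (Fin d)}

theorem add_smul_mem {e : EuclideanSpace ℝ (Fin d)} (he : ‖e‖ = 1) {t : ℝ} (ht : 0 ≤ t)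
    (htr : t < r) : X₀ + t • e ∈ ball X₀ r := by
  simp [norm_smul, he, abs_of_nonneg ht, htr]

theorem hasDerivAt_ray (h : RadialPerturbation p C M r u φ ψ X₀)
    {e : EuclideanSpace ℝ (Fin d)} (he : ‖e‖ = 1) {t : ℝ} (ht : 0 ≤ t) (htr : t < r) :
    HasDerivAt (fun x : ℝ => φ (X₀ + x • e)) (fderiv ℝ φ (X₀ + t • e) e) t := by
  have h1 : HasDerivAt (fun x : ℝ => X₀ + x • e) e t := by
    simpa using ((hasDerivAt_id t).smul_const e).const_add X₀
  exact (h.hasFDerivAt (add_smul_mem he ht htr)).comp_hasDerivAt t h1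

theorem hasDerivAt_fderiv_ray (h : RadialPerturbation p C M r u φ ψ X₀)
    {e : EuclideanSpace ℝ (Fin d)} (he : ‖e‖ = 1) {t : ℝ} (ht : 0 ≤ t) (htr : t < r) :
    HasDerivAt (fun x : ℝ => fderiv ℝ φ (X₀ + x • e) e)
      (fderiv ℝ (fderiv ℝ φ) (X₀ + t • e) e e) t := by
  have h1 : HasDerivAt (fun x : ℝ => X₀ + x • e) e t := by
    simpa using ((hasDerivAt_id t).smul_const e).const_add X₀
  have h2 := (h.hasFDerivAt_fderiv (add_smul_mem he ht htr)).comp_hasDerivAt t h1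
  simpa using h2.clm_apply (hasDerivAt_const t e)

-- The difference `u - φ` depends on the radius alone, so touching along one ray extends to touching
-- in a full neighbourhood: correct the parabola by φ along the ray, make it radial, and add φ back.
-- The price is the tangential curvature, which is the term |s|/t.
set_option maxHeartbeats 800000 in
theorem radial_test (h : RadialPerturbation p C M r u φ ψ X₀)
    {e : EuclideanSpace ℝ (Fin d)} (he : ‖e‖ = 1) {t s N : ℝ} (ht : 0 < t) (htr : t < r)
    (hs : s ≠ 0) (hN : 0 ≤ N) (hw : ∀ᶠ x in 𝓝 t,
      u (X₀ + t • e) + s * (x - t) + N / 2 * (x - t) ^ 2 ≤ u (X₀ + x • e)) :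
    |s| ^ (p - 2) * (N - (d + p - 2) * (3 * M + |s| / t)) ≤ C := by
  set Y := X₀ + t • e with hYdef
  have hYb : Y ∈ ball X₀ r := add_smul_mem he ht.le htr
  have hYX : Y - X₀ = t • e := by simp [hYdef]
  have hYn : ‖Y - X₀‖ = t := by rw [hYX, norm_smul, he, mul_one, Real.norm_of_nonneg ht.le]
  have hYne : ∀ᶠ X in 𝓝 Y, X ≠ X₀ :=
    isOpen_ne.mem_nhds (sub_ne_zero.1 (norm_ne_zero_iff.1 (by rw [hYn]; exact ht.ne')))
  have hball : ∀ᶠ X in 𝓝 Y, X ∈ ball X₀ r := isOpen_ball.mem_nhds hYb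
  have htend : Tendsto (fun X => ‖X - X₀‖) (𝓝 Y) (𝓝 t) := by
    rw [← hYn]
    exact (by fun_prop : Continuous fun X : EuclideanSpace ℝ (Fin d) => ‖X - X₀‖).tendsto Y
  set g : ℝ → ℝ := fun x => u Y + s * (x - t) + N / 2 * (x - t) ^ 2 - φ (X₀ + x • e) with hg
  set g' : ℝ → ℝ := fun x => s + N * (x - t) - fderiv ℝ φ (X₀ + x • e) e with hg'
  have hgd : ∀ x, 0 ≤ x → x < r → HasDerivAt g (g' x) x := by
    intro x hx hxr
    have h1 : HasDerivAt (fun x => u Y + s * (x - t) + N / 2 * (x - t) ^ 2)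
        (s + N * (x - t)) x := by
      have h2 := (hasDerivAt_id x).sub_const t
      convert! ((h2.const_mul s).const_add (u Y)).add ((h2.pow 2).const_mul (N / 2)) using 1
      simp
      ring
    exact h1.sub (h.hasDerivAt_ray he hx hxr)
  have hgdd : HasDerivAt g' (N - fderiv ℝ (fderiv ℝ φ) Y e e) t := by
    have h1 : HasDerivAt (fun x => s + N * (x - t)) N t := by
      simpa using (((hasDerivAt_id t).sub_const t).const_mul N).const_add s
    exact h1.sub (h.hasDerivAt_fderiv_ray he ht.le htr)
  set f : EuclideanSpace ℝ (Fin d) → ℝ := fun X => φ X + g ‖X - X₀‖ with hf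
  have hft : TouchesFromBelow f u Y := by
    constructor
    · simp only [hf, hg, hYn]
      rw [← hYdef]
      ring
    · filter_upwards [htend.eventually hw, hball] with X hX hXb
      have h1 : ‖X - X₀‖ < r := by simpa [dist_eq_norm] using hXb
      have h2 := h.eq _ (add_smul_mem (X₀ := X₀) he (norm_nonneg (X - X₀)) h1)
      rw [add_sub_cancel_left, norm_smul, he, mul_one, norm_norm] at h2
      simp only [hf, hg]
      rw [h.eq X hXb]
      linarith
  have hfd : fderiv ℝ f =ᶠ[𝓝 Y] fun X =>
      fderiv ℝ φ X + (g' ‖X - X₀‖ / ‖X - X₀‖) • innerSL ℝ (X - X₀) := by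
    filter_upwards [hball, hYne] with X hX hXne
    exact ((h.hasFDerivAt hX).add ((hgd _ (norm_nonneg _)
      (by simpa [dist_eq_norm] using hX)).hasFDerivAt_comp_norm_sub hXne)).fderiv
  have hfc : ContDiffAt ℝ 2 f Y := by
    have h1 : ContDiffAt ℝ 2 (fun X => ‖X - X₀‖) Y :=
      (contDiffAt_id.sub contDiffAt_const).norm ℝ (sub_ne_zero.2 hYne.self_of_nhds)
    refine (h.contDiffAt hYb).add ?_
    have h2 : ContDiffAt ℝ 2 (fun X => X₀ + ‖X - X₀‖ • e) Y :=
      contDiffAt_const.add (h1.smul contDiffAt_const)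
    have h3 : ContDiffAt ℝ 2 (fun X => φ (X₀ + ‖X - X₀‖ • e)) Y := by
      refine ContDiffAt.comp Y (g := φ) ?_ h2
      rw [hYn]
      exact h.contDiffAt hYb
    simp only [hg]
    have h4 : ContDiffAt ℝ 2 (fun X => ‖X - X₀‖ - t) Y := h1.sub contDiffAt_const
    exact ((contDiffAt_const.add (contDiffAt_const.mul h4)).add
      (contDiffAt_const.mul (h4.pow 2))).sub h3
  have hkd : HasDerivAt (fun x => g' x / x)
      (((N - fderiv ℝ (fderiv ℝ φ) Y e e) * t - g' t) / t ^ 2) t := by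
    exact (hgdd.div (hasDerivAt_id t) ht.ne').congr_deriv (by simp)
  obtain ⟨L, hL, hLv⟩ := HasDerivAt.exists_hasFDerivAt_norm_sub_smul
    (k := fun x => g' x / x) hYne.self_of_nhds (by rw [hYn]; exact hkd)
  have hfdd : ∀ v, fderiv ℝ (fderiv ℝ f) Y v v = fderiv ℝ (fderiv ℝ φ) Y v v +
      (g' t / t * (‖v‖ ^ 2 - ⟪e, v⟫ ^ 2) + (N - fderiv ℝ (fderiv ℝ φ) Y e e) * ⟪e, v⟫ ^ 2) := by
    intro v
    rw [hfd.fderiv_eq]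
    refine (congrArg (fun L => L v v) ((h.hasFDerivAt_fderiv hYb).add hL).fderiv).trans ?_
    simp only [add_apply, hLv]
    rw [hYn, hYX, real_inner_smul_left]
    field_simp
    ring
  have hg'b : |g' t / t| ≤ M + |s| / t := by
    have h1 : |fderiv ℝ φ Y e| ≤ M * t := by
      have := (fderiv ℝ φ Y).le_opNorm e
      rw [he, mul_one, Real.norm_eq_abs] at this
      refine this.trans ?_
      rw [← hYn]
      exact h.fderiv_le Y hYb
    have h2 : g' t = s - fderiv ℝ φ Y e := by simp [hg', ← hYdef]
    rw [abs_div, abs_of_pos ht, h2, div_le_iff₀ ht]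
    have h3 := abs_sub s (fderiv ℝ φ Y e)
    have h4 : (M + |s| / t) * t = M * t + |s| := by field_simp
    linarith
  -- The φ-terms cancel in the direction `e`, so the derivative of `f` along the ray is exactly `s`.
  have hGs : |s| ≤ ‖gradient f Y‖ := by
    have h1 : ⟪gradient f Y, e⟫ = s := by
      rw [inner_gradient_left, hfd.self_of_nhds]
      simp only [add_apply, smul_apply, smul_eq_mul, innerSL_apply_apply]
      rw [hYn, hYX, real_inner_smul_left, real_inner_self_eq_norm_sq, he]
      simp only [hg', ← hYdef, sub_self]
      field_simp
      ring
    rw [← h1]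
    simpa [he] using abs_real_inner_le_norm (gradient f Y) e
  -- The negative part 3M + |s|/t is made of M from D²φ, M from the correction of the radial second
  -- derivative, and M + |s|/t from the tangential coefficient g'(t)/t.
  refine h.test_below hYb hfc hft hN he (fun v => ?_) (abs_pos.2 hs) hGs
  rw [hfdd]
  have h2 : ⟪e, v⟫ ^ 2 ≤ ‖v‖ ^ 2 := by
    rw [sq_le_sq, abs_norm]
    simpa [he] using abs_real_inner_le_norm e v
  have h3 := (abs_le.1 (h.hess_apply_le hYb v)).1
  have h4 := (abs_le.1 (h.hess_apply_le hYb e)).2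
  rw [he] at h4
  have h5 : -((M + |s| / t) * ‖v‖ ^ 2) ≤ g' t / t * (‖v‖ ^ 2 - ⟪e, v⟫ ^ 2) := by
    have h6 : |g' t / t * (‖v‖ ^ 2 - ⟪e, v⟫ ^ 2)| ≤ (M + |s| / t) * ‖v‖ ^ 2 := by
      rw [abs_mul, abs_of_nonneg (sub_nonneg.2 h2)]
      have : ‖v‖ ^ 2 - ⟪e, v⟫ ^ 2 ≤ ‖v‖ ^ 2 := by linarith [sq_nonneg ⟪e, v⟫]
      have h7 := (abs_nonneg (g' t / t)).trans hg'b
      exact mul_le_mul hg'b this (sub_nonneg.2 h2) h7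
    exact (abs_le.1 h6).1
  have h6 : fderiv ℝ (fderiv ℝ φ) Y e e * ⟪e, v⟫ ^ 2 ≤ M * ‖v‖ ^ 2 := by
    calc _ ≤ M * ⟪e, v⟫ ^ 2 := mul_le_mul_of_nonneg_right (by linarith) (sq_nonneg _)
      _ ≤ _ := mul_le_mul_of_nonneg_left h2 h.M_nonneg
  linarith

end RadialPerturbation

/-! ### Slope estimates along a ray -/

namespace RadialPerturbation

variable {d : ℕ} {p C M r : ℝ} {u φ : EuclideanSpace ℝ (Fin d) → ℝ} {ψ : ℝ → ℝ}
  {X₀ : EuclideanSpace ℝ (Fin d)}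

theorem continuousOn_ray (h : RadialPerturbation p C M r u φ ψ X₀)
    {e : EuclideanSpace ℝ (Fin d)} (he : ‖e‖ = 1) :
    ContinuousOn (fun x : ℝ => u (X₀ + x • e)) (Set.Ico 0 r) :=
  h.continuousOn.comp (by fun_prop) fun _ hx => add_smul_mem he hx.1 hx.2

/-- A convex kink of the restriction to a ray is controlled by the equation. -/
theorem kink_test (h : RadialPerturbation p C M r u φ ψ X₀)
    {e : EuclideanSpace ℝ (Fin d)} (he : ‖e‖ = 1) {a b c s₁ s₂ : ℝ} (ha : 0 < a) (hac : a < c)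
    (hcb : c < b) (hbr : b < r) (hs : s₁ < s₂) (hs0 : ∀ s ∈ Set.Icc s₁ s₂, s ≠ 0)
    (h₁ : u (X₀ + c • e) - u (X₀ + a • e) ≤ s₁ * (c - a))
    (h₂ : s₂ * (b - c) ≤ u (X₀ + b • e) - u (X₀ + c • e)) :
    ∃ t ∈ Set.Ioo a b, ∃ s ∈ Set.Icc s₁ s₂,
      |s| ^ (p - 2) * ((s₂ - s₁) / (b - a) - (d + p - 2) * (3 * M + |s| / t)) ≤ C := by
  obtain ⟨t, ht, s, hsm, hP⟩ := exists_parabola_touching_below (w := fun x => u (X₀ + x • e))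
    hac hcb ((h.continuousOn_ray he).mono fun x hx => ⟨ha.le.trans hx.1, hx.2.trans_lt hbr⟩) hs h₁ h₂
  refine ⟨t, ht, s, hsm, h.radial_test he (ha.trans ht.1) (ht.2.trans hbr) (hs0 s hsm)
    (div_nonneg (by linarith) (by linarith)) ?_⟩
  filter_upwards [Icc_mem_nhds ht.1 ht.2] with x hx using hP x hx

/-- Half the aperture of the dyadic annuli in which slopes are compared. -/
noncomputable def ratioConst (d : ℕ) (p : ℝ) : ℝ := 1 / (16 * (d + p))

/-- The constant in the bound of the slopes along a ray. -/
noncomputable def slopeConst (d : ℕ) (p C M : ℝ) : ℝ :=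
  1 + C + M + 2 * (growthConst d p C M + M) / ratioConst d p

/-- The constant in the Hölder bound of the slopes along a ray. -/
noncomputable def holderConst (d : ℕ) (p C M : ℝ) : ℝ :=
  4 * ((d + p) * (3 * M + 4 * slopeConst d p C M) + 1 + C)

theorem ratioConst_pos (h : RadialPerturbation p C M r u φ ψ X₀) : 0 < ratioConst d p := by
  have := h.two_le
  unfold ratioConst
  positivity

theorem ratioConst_le (h : RadialPerturbation p C M r u φ ψ X₀) : ratioConst d p ≤ 1 / 2 := by
  have := h.two_le
  unfold ratioConst
  have hd : (0 : ℝ) ≤ d := by positivity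
  rw [div_le_div_iff₀ (by positivity) (by norm_num)]
  linarith

theorem growthConst_nonneg (h : RadialPerturbation p C M r u φ ψ X₀) : 0 ≤ growthConst d p C M := by
  have := h.two_le
  have := h.C_nonneg
  have := h.M_nonneg
  unfold growthConst
  positivity

theorem ray_growth (h : RadialPerturbation p C M r u φ ψ X₀)
    {e : EuclideanSpace ℝ (Fin d)} (he : ‖e‖ = 1) {t : ℝ} (ht : 0 < t) (htr : t < r) :
    |u (X₀ + t • e) - ψ 0| ≤ (growthConst d p C M + M) * (t ^ (1 / (p - 1)) * t) := by
  have hp := h.two_le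
  have h1 := h.abs_radial_growth he ht htr
  have hmem := add_smul_mem (X₀ := X₀) he ht.le htr
  have h2 := h.abs_apply_le hmem
  have h3 := h.eq _ hmem
  rw [add_sub_cancel_left, norm_smul, he, mul_one, Real.norm_of_nonneg ht.le] at h2 h3
  rw [h3]
  have h4 : t ^ 2 ≤ t ^ (1 / (p - 1)) * t := by
    rw [pow_two]
    gcongr
    have : 1 / (p - 1) ≤ 1 := by rw [div_le_one (by linarith)]; linarith
    simpa using Real.rpow_le_rpow_of_exponent_ge ht (htr.le.trans h.r_le) this
  rw [Real.rpow_add ht, Real.rpow_one, mul_comm t] at h1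
  have h5 : φ (X₀ + t • e) + ψ t - ψ 0 = φ (X₀ + t • e) + (ψ t - ψ 0) := by ring
  rw [h5, add_mul]
  refine (abs_add_le _ _).trans ?_
  have := mul_le_mul_of_nonneg_left h4 h.M_nonneg
  linarith

-- The growth estimate bounds the slope of the preceding chord from ((1-κ)c) to c by Λc^α. A slope
-- above 2Λc^α on the next chord would produce a kink, with slopes between Λc^α and 2Λc^α and thus
-- away from zero, that violates the equation.
set_option maxHeartbeats 800000 in
theorem slope_le (h : RadialPerturbation p C M r u φ ψ X₀)
    {e : EuclideanSpace ℝ (Fin d)} (he : ‖e‖ = 1) {c b : ℝ} (hc : 0 < c) (hcb : c < b)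
    (hbr : b < r) (hbc : b ≤ (1 + ratioConst d p) * c) :
    u (X₀ + b • e) - u (X₀ + c • e) ≤
      2 * slopeConst d p C M * c ^ (1 / (p - 1)) * (b - c) := by
  by_contra! hlt
  have hp := h.two_le
  have hC := h.C_nonneg
  have hM := h.M_nonneg
  have hκ := h.ratioConst_pos
  have hκ2 := h.ratioConst_le
  have hK := h.growthConst_nonneg
  have hd : (0 : ℝ) ≤ d := by positivity
  set κ := ratioConst d p with hκdef
  set K := growthConst d p C M + M with hKdef
  have hK0 : 0 ≤ K := by positivity
  set Λ := slopeConst d p C M with hΛdef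
  have hΛ : Λ = 1 + C + M + 2 * K / κ := rfl
  have hKκ : 0 ≤ 2 * K / κ := by positivity
  have hΛ1 : 1 + C ≤ Λ := by linarith
  have hΛM : M ≤ Λ := by linarith
  have hΛK : 2 * K ≤ κ * Λ := by
    have : 2 * K / κ ≤ Λ := by linarith
    rw [div_le_iff₀ hκ] at this
    linarith
  have hΛ0 : 0 < Λ := by linarith
  set α := 1 / (p - 1) with hα
  have hα0 : 0 < α := by rw [hα]; apply one_div_pos.2; linarith
  have hα1 : α ≤ 1 := by rw [hα, div_le_one (by linarith)]; linarith
  have hαp : α * (p - 1) = 1 := by rw [hα]; field_simp [show p - 1 ≠ 0 by linarith]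
  have hc1 : c < 1 := by linarith [h.r_le]
  have hcα : 0 < c ^ α := by positivity
  have hcle : c ≤ c ^ α := by
    simpa using Real.rpow_le_rpow_of_exponent_ge hc hc1.le hα1
  set a := (1 - κ) * c with ha
  have ha2 : c / 2 ≤ a := by rw [ha]; nlinarith
  have ha0 : 0 < a := by linarith
  have hac : a < c := by rw [ha]; nlinarith
  have hca : c - a = κ * c := by rw [ha]; ring
  have hba : b - a ≤ 2 * κ * c := by rw [ha]; linarith
  have hΛc : 0 < Λ * c ^ α := by positivity
  obtain ⟨t, ht, s, hs, hts⟩ := h.kink_test he ha0 hac hcb hbr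
    (s₁ := Λ * c ^ α) (s₂ := 2 * Λ * c ^ α) (by linarith)
    -- The growth estimate at both endpoints gives an increment of at most 2Kc^(1+α). The summand
    -- 2K/κ of Λ makes this at most Λc^α times the length κc.
    (fun s hs => (hΛc.trans_le hs.1).ne') (by
      have h1 := abs_le.1 (h.ray_growth he hc (by linarith))
      have h2 := abs_le.1 (h.ray_growth he ha0 (by linarith))
      have h3 : a ^ α * a ≤ c ^ α * c := by
        have := Real.rpow_le_rpow ha0.le hac.le hα0.le
        exact mul_le_mul this hac.le ha0.le hcα.le
      have h4 := mul_le_mul_of_nonneg_left h3 hK0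
      have h5 := mul_le_mul_of_nonneg_right hΛK (by positivity : 0 ≤ c ^ α * c)
      rw [hca]
      nlinarith [h1.2, h2.1]) (by linarith)
  have hs0 : 0 < s := hΛc.trans_le hs.1
  rw [abs_of_pos hs0] at hts
  have hba0 : 0 < b - a := by linarith
  -- In units of Λc^α/c, the kink contributes at least 8(d + p) by the choice of κ, and the bracket
  -- 3M + s/t is at most 3 + 4 = 7. At least one unit remains.
  have hX : Λ * c ^ α / c ≤ (2 * Λ * c ^ α - Λ * c ^ α) / (b - a) -
      (d + p - 2) * (3 * M + s / t) := by
    have h1 : s / t ≤ 4 * (Λ * c ^ α / c) := by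
      rw [div_le_iff₀ (ha0.trans ht.1)]
      have h2 : Λ * c ^ α / c * c = Λ * c ^ α := by field_simp
      have h3 : Λ * c ^ α / c * (c / 2) ≤ Λ * c ^ α / c * t :=
        mul_le_mul_of_nonneg_left (ha2.trans ht.1.le) (by positivity)
      linarith [hs.2]
    have h2 : M ≤ Λ * c ^ α / c := by
      rw [le_div_iff₀ hc]
      exact mul_le_mul hΛM hcle hc.le hΛ0.le
    have h3 : 8 * (d + p) * (Λ * c ^ α / c) ≤ (2 * Λ * c ^ α - Λ * c ^ α) / (b - a) := by
      rw [le_div_iff₀ hba0]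
      have h4 : 8 * (d + p) * (2 * κ) = 1 := by
        rw [hκdef, ratioConst]
        have : (d : ℝ) + p ≠ 0 := by linarith
        field_simp
        norm_num
      calc 8 * (d + p) * (Λ * c ^ α / c) * (b - a)
          ≤ 8 * (d + p) * (Λ * c ^ α / c) * (2 * κ * c) :=
            mul_le_mul_of_nonneg_left hba (by positivity)
        _ = 8 * (d + p) * (2 * κ) * (Λ * c ^ α) := by field_simp
        _ = _ := by rw [h4]; ring
    have h4 : (d + p - 2) * (3 * M + s / t) ≤ (d + p - 2) * (7 * (Λ * c ^ α / c)) :=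
      mul_le_mul_of_nonneg_left (by linarith) (by linarith)
    have h5 : 0 ≤ (d + p) * (Λ * c ^ α / c) := by positivity
    have h6 : 0 < Λ * c ^ α / c := by positivity
    linarith
  have h1 : (Λ * c ^ α) ^ (p - 2) * (Λ * c ^ α / c) ≤ C := by
    refine le_trans ?_ hts
    exact mul_le_mul (Real.rpow_le_rpow hΛc.le hs.1 (by linarith)) hX (by positivity)
      (by positivity)
  have h2 : (Λ * c ^ α) ^ (p - 2) * (Λ * c ^ α / c) = Λ ^ (p - 1) := by
    have e2 : (Λ * c ^ α) ^ (p - 1) = (Λ * c ^ α) ^ (p - 2) * (Λ * c ^ α) := by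
      rw [← Real.rpow_add_one (by positivity)]
      ring_nf
    rw [← mul_div_assoc, ← e2, Real.mul_rpow hΛ0.le hcα.le, ← Real.rpow_mul hc.le, hαp,
      Real.rpow_one]
    field_simp
  have h3 : 1 + C ≤ Λ ^ (p - 1) :=
    (one_add_le_rpow hC (by linarith)).trans
      (Real.rpow_le_rpow (by linarith) hΛ1 (by linarith))
  linarith

theorem abs_slope_le (h : RadialPerturbation p C M r u φ ψ X₀)
    {e : EuclideanSpace ℝ (Fin d)} (he : ‖e‖ = 1) {c b : ℝ} (hc : 0 < c) (hcb : c < b)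
    (hbr : b < r) (hbc : b ≤ (1 + ratioConst d p) * c) :
    |u (X₀ + b • e) - u (X₀ + c • e)| ≤
      2 * slopeConst d p C M * c ^ (1 / (p - 1)) * (b - c) := by
  have h1 := h.slope_le he hc hcb hbr hbc
  have h2 := h.neg.slope_le he hc hcb hbr hbc
  simp only [Pi.neg_apply] at h2
  exact abs_le.2 ⟨by linarith, h1⟩

theorem slopeConst_pos (h : RadialPerturbation p C M r u φ ψ X₀) : 0 < slopeConst d p C M := by
  have := h.C_nonneg
  have := h.M_nonneg
  have := h.growthConst_nonneg
  have := h.ratioConst_pos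
  unfold slopeConst
  positivity

theorem holderConst_pos (h : RadialPerturbation p C M r u φ ψ X₀) : 0 < holderConst d p C M := by
  have := h.two_le
  have := h.C_nonneg
  have := h.M_nonneg
  have := h.slopeConst_pos
  unfold holderConst
  positivity

-- A jump of slope larger than Hl^α over length l gives a parabola of opening about l^(α-1). The
-- lower-order terms are of order a^(α-1) by the slope bound, and this is no larger because l ≤ a
-- and α ≤ 1.
set_option maxHeartbeats 800000 in
theorem slope_sub_slope_le (h : RadialPerturbation p C M r u φ ψ X₀)
    {e : EuclideanSpace ℝ (Fin d)} (he : ‖e‖ = 1) {a b c q₁ q₂ : ℝ} (ha : 0 < a) (hac : a < c)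
    (hcb : c < b) (hbr : b < r) (hba : b ≤ (1 + ratioConst d p) * a)
    (h₁ : u (X₀ + c • e) - u (X₀ + a • e) = q₁ * (c - a))
    (h₂ : u (X₀ + b • e) - u (X₀ + c • e) = q₂ * (b - c)) :
    q₂ - q₁ ≤ holderConst d p C M * (b - a) ^ (1 / (p - 1)) := by
  by_contra! hlt
  have hp := h.two_le
  have hC := h.C_nonneg
  have hM := h.M_nonneg
  have hκ := h.ratioConst_pos
  have hκ2 := h.ratioConst_le
  have hd : (0 : ℝ) ≤ d := by positivity
  have hΛ0 := h.slopeConst_pos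
  have hq₁ := h.abs_slope_le he ha hac (by linarith) (by linarith)
  have hq₂ := h.abs_slope_le he (ha.trans hac) hcb hbr (hba.trans (by
    apply mul_le_mul_of_nonneg_left hac.le; linarith))
  set κ := ratioConst d p with hκdef
  set Λ := slopeConst d p C M with hΛdef
  set α := 1 / (p - 1) with hα
  have hα0 : 0 < α := by rw [hα]; apply one_div_pos.2; linarith
  have hα1 : α ≤ 1 := by rw [hα, div_le_one (by linarith)]; linarith
  have hαp : α * (p - 1) = 1 := by rw [hα]; field_simp [show p - 1 ≠ 0 by linarith]
  have ha1 : a < 1 := by linarith [h.r_le]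
  have haα : 0 < a ^ α := by positivity
  set E := (d + p) * (3 * M + 4 * Λ) with hE
  have hE0 : 0 ≤ E := by positivity
  have hHdef : holderConst d p C M = 4 * (E + 1 + C) := rfl
  rw [hHdef] at hlt
  set H := E + 1 + C with hH
  rw [h₁, abs_mul, abs_of_pos (by linarith : 0 < c - a)] at hq₁
  rw [h₂, abs_mul, abs_of_pos (by linarith : 0 < b - c)] at hq₂
  replace hq₁ := le_of_mul_le_mul_right hq₁ (by linarith)
  replace hq₂ := le_of_mul_le_mul_right hq₂ (by linarith)
  have hc2 : c ≤ 2 * a := by nlinarith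
  have hcα : c ^ α ≤ 2 * a ^ α := by
    calc c ^ α ≤ (2 * a) ^ α := Real.rpow_le_rpow (by linarith) hc2 hα0.le
      _ = 2 ^ α * a ^ α := Real.mul_rpow (by norm_num) ha.le
      _ ≤ 2 * a ^ α := by
        gcongr
        simpa using Real.rpow_le_rpow_of_exponent_le (by norm_num : (1 : ℝ) ≤ 2) hα1
  have hQ₁ : |q₁| ≤ 4 * Λ * a ^ α := by
    have : 0 < Λ * a ^ α := by positivity
    linarith
  have hQ₂ : |q₂| ≤ 4 * Λ * a ^ α := by
    have := mul_le_mul_of_nonneg_left hcα hΛ0.le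
    linarith
  set l := b - a with hl
  have hl0 : 0 < l := by linarith
  have hla : l ≤ a := by nlinarith
  -- The interval from `q₁` to `q₂` may contain zero, where the equation gives no control. A quarter
  -- of it, at the end farther from zero, keeps |s| ≥ δ and still has a jump of δ; this explains the
  -- factor 4 in `holderConst`.
  set δ := (q₂ - q₁) / 4 with hδ
  have hδlt : H * l ^ α < δ := by linarith
  have hH0 : 0 < H := by linarith
  have hlα : 0 < l ^ α := by positivity
  have hδ0 : 0 < δ := lt_trans (by positivity) hδlt
  obtain ⟨s₁, s₂, hs12, hqs, hsq, hsδ⟩ : ∃ s₁ s₂ : ℝ, s₂ - s₁ = δ ∧ q₁ ≤ s₁ ∧ s₂ ≤ q₂ ∧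
      ∀ s ∈ Set.Icc s₁ s₂, δ ≤ |s| := by
    rcases le_total 0 (q₁ + q₂) with h0 | h0
    · refine ⟨q₂ - δ, q₂, by ring, by linarith, le_rfl, fun s hs => ?_⟩
      exact le_trans (by linarith [hs.1]) (le_abs_self s)
    · refine ⟨q₁, q₁ + δ, by ring, le_rfl, by linarith, fun s hs => ?_⟩
      exact le_trans (by linarith [hs.2]) (neg_le_abs s)
  obtain ⟨t, ht, s, hs, hts⟩ := h.kink_test he ha hac hcb hbr (s₁ := s₁) (s₂ := s₂) (by linarith)
    (fun s hs => abs_pos.1 (hδ0.trans_le (hsδ s hs)))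
    (by rw [h₁]; exact mul_le_mul_of_nonneg_right hqs (by linarith))
    (by rw [h₂]; exact mul_le_mul_of_nonneg_right hsq (by linarith))
  have hsabs : |s| ≤ 4 * Λ * a ^ α := by
    refine abs_le.2 ⟨?_, ?_⟩
    · linarith [(abs_le.1 hQ₁).1, hs.1]
    · linarith [(abs_le.1 hQ₂).2, hs.2]
  have hdecr : a ^ α / a ≤ l ^ α / l := by
    rw [← Real.rpow_sub_one ha.ne', ← Real.rpow_sub_one hl0.ne']
    exact Real.rpow_le_rpow_of_nonpos hl0 hla (by linarith)
  have hone : 1 ≤ a ^ α / a := by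
    rw [le_div_iff₀ ha, one_mul]
    simpa using Real.rpow_le_rpow_of_exponent_ge ha ha1.le hα1
  have hX : (1 + C) * (l ^ α / l) ≤ (s₂ - s₁) / l - (d + p - 2) * (3 * M + |s| / t) := by
    have h1 : |s| / t ≤ 4 * Λ * (a ^ α / a) := by
      rw [← mul_div_assoc]
      exact div_le_div₀ (by positivity) hsabs ha ht.1.le
    have h2 : 3 * M + |s| / t ≤ (3 * M + 4 * Λ) * (l ^ α / l) := by
      have h3 : 3 * M * 1 ≤ 3 * M * (l ^ α / l) :=
        mul_le_mul_of_nonneg_left (hone.trans hdecr) (by positivity)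
      have h4 : 4 * Λ * (a ^ α / a) ≤ 4 * Λ * (l ^ α / l) :=
        mul_le_mul_of_nonneg_left hdecr (by positivity)
      linarith
    have h3 : 0 ≤ (3 * M + 4 * Λ) * (l ^ α / l) := by positivity
    have h4 : (d + p - 2) * (3 * M + |s| / t) ≤ E * (l ^ α / l) := by
      rw [hE, mul_assoc]
      calc _ ≤ (d + p - 2) * ((3 * M + 4 * Λ) * (l ^ α / l)) :=
            mul_le_mul_of_nonneg_left h2 (by linarith)
        _ ≤ _ := mul_le_mul_of_nonneg_right (by linarith) h3
    have h5 : H * (l ^ α / l) ≤ (s₂ - s₁) / l := by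
      rw [hs12, ← mul_div_assoc]
      exact div_le_div_of_nonneg_right hδlt.le hl0.le
    have h6 : H * (l ^ α / l) = E * (l ^ α / l) + (1 + C) * (l ^ α / l) := by rw [hH]; ring
    linarith
  have h1 : (l ^ α) ^ (p - 2) * ((1 + C) * (l ^ α / l)) ≤ C := by
    refine le_trans ?_ hts
    refine mul_le_mul (Real.rpow_le_rpow hlα.le ?_ (by linarith)) hX (by positivity)
      (by positivity)
    refine le_trans ?_ (hsδ s hs)
    refine le_trans ?_ hδlt.le
    have : 1 ≤ H := by linarith
    exact le_mul_of_one_le_left hlα.le this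
  -- Scale invariance, again from α(p - 1) = 1; the test then reads 1 + C ≤ C.
  have h2 : (l ^ α) ^ (p - 2) * (l ^ α / l) = 1 := by
    have e2 : (l ^ α) ^ (p - 1) = (l ^ α) ^ (p - 2) * (l ^ α) := by
      rw [← Real.rpow_add_one (by positivity)]
      ring_nf
    rw [← mul_div_assoc, ← e2, ← Real.rpow_mul hl0.le, hαp, Real.rpow_one, div_self hl0.ne']
  have h3 : (l ^ α) ^ (p - 2) * ((1 + C) * (l ^ α / l)) =
    (1 + C) * ((l ^ α) ^ (p - 2) * (l ^ α / l)) := by ring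
  rw [h3, h2] at h1
  linarith

theorem abs_slope_sub_slope_le (h : RadialPerturbation p C M r u φ ψ X₀)
    {e : EuclideanSpace ℝ (Fin d)} (he : ‖e‖ = 1) {a b c : ℝ} (ha : 0 < a) (hac : a < c)
    (hcb : c < b) (hbr : b < r) (hba : b ≤ (1 + ratioConst d p) * a) :
    |slope (fun x : ℝ => u (X₀ + x • e)) c b - slope (fun x : ℝ => u (X₀ + x • e)) a c| ≤
      holderConst d p C M * (b - a) ^ (1 / (p - 1)) := by
  have hca : c - a ≠ 0 := by linarith
  have hbc : b - c ≠ 0 := by linarith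
  rw [slope_def_field, slope_def_field]
  refine abs_le.2 ⟨?_, h.slope_sub_slope_le he ha hac hcb hbr hba
    (div_mul_cancel₀ _ hca).symm (div_mul_cancel₀ _ hbc).symm⟩
  have := h.neg.slope_sub_slope_le he ha hac hcb hbr hba
    (div_mul_cancel₀ _ hca).symm (div_mul_cancel₀ _ hbc).symm
  simp only [Pi.neg_apply] at this
  rw [← neg_sub', ← neg_sub', neg_div, neg_div] at this
  linarith

end RadialPerturbation

/-! ### From slopes to Hölder derivatives in one variable -/

/-- The slope over a union of adjacent intervals is the length-weighted mean of the two slopes. This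
reduces chords with a common endpoint to adjacent chords. -/
theorem slope_sub_slope_eq {w : ℝ → ℝ} {x y z : ℝ} (hxy : x < y) (hyz : y < z) :
    slope w x z - slope w x y = (z - y) / (z - x) * (slope w y z - slope w x y) ∧
    slope w x z - slope w y z = (y - x) / (z - x) * (slope w x y - slope w y z) := by
  have h1 : y - x ≠ 0 := by linarith
  have h2 : z - y ≠ 0 := by linarith
  have h3 : z - x ≠ 0 := by linarith
  simp only [slope_def_field]
  constructor <;> field_simp <;> ring

section holder

variable {w : ℝ → ℝ} {r κ H α : ℝ}

theorem abs_slope_sub_slope_le_of_lt (hw : ∀ a c b, 0 < a → a < c → c < b → b < r →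
      b ≤ (1 + κ) * a → |slope w c b - slope w a c| ≤ H * (b - a) ^ α) (hκ : 0 < κ) (hα : 0 < α)
    (hH : 0 ≤ H) {a b x y z : ℝ} (ha : 0 < a) (hbr : b < r) (hba : b ≤ (1 + κ) * a)
    (hx : x ∈ Set.Icc a b) (hy : y ∈ Set.Icc a b) (hz : z ∈ Set.Icc a b)
    (hxy : x ≠ y) (hxz : x ≠ z) (hyz : y < z) :
    |slope w x y - slope w x z| ≤ H * (b - a) ^ α := by
  have key : ∀ s t q, s ∈ Set.Icc a b → t ∈ Set.Icc a b → s < q → q < t →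
      |slope w q t - slope w s q| ≤ H * (b - a) ^ α := by
    intro s t q hs ht hsq hqt
    refine (hw s q t (ha.trans_le hs.1) hsq hqt (ht.2.trans_lt hbr) ?_).trans ?_
    · refine (ht.2.trans hba).trans ?_
      have := hs.1
      gcongr
    · refine mul_le_mul_of_nonneg_left ?_ hH
      refine Real.rpow_le_rpow ?_ ?_ hα.le <;> linarith [hs.1, ht.2]
  rcases lt_or_gt_of_ne hxy with h1 | h1
  · have h2 := key x z y hx hz h1 hyz
    rw [abs_sub_comm, (slope_sub_slope_eq h1 hyz).1, abs_mul]
    refine le_trans ?_ h2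
    refine mul_le_of_le_one_left (abs_nonneg _) ?_
    rw [abs_of_nonneg (div_nonneg (by linarith) (by linarith)), div_le_one (by linarith)]
    linarith
  · rcases lt_or_gt_of_ne hxz with h3 | h3
    · have h2 := key y z x hy hz h1 h3
      rwa [slope_comm w x y, abs_sub_comm]
    · have h2 := key y x z hy hx hyz h3
      rw [slope_comm w x y, slope_comm w x z, (slope_sub_slope_eq hyz h3).2, abs_mul]
      rw [abs_sub_comm] at h2
      refine le_trans ?_ h2
      refine mul_le_of_le_one_left (abs_nonneg _) ?_
      rw [abs_of_nonneg (div_nonneg (by linarith) (by linarith)), div_le_one (by linarith)]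
      linarith

theorem abs_slope_sub_slope_le_of_ne (hw : ∀ a c b, 0 < a → a < c → c < b → b < r →
      b ≤ (1 + κ) * a → |slope w c b - slope w a c| ≤ H * (b - a) ^ α) (hκ : 0 < κ) (hα : 0 < α)
    (hH : 0 ≤ H) {a b x y z : ℝ} (ha : 0 < a) (hbr : b < r) (hba : b ≤ (1 + κ) * a)
    (hx : x ∈ Set.Icc a b) (hy : y ∈ Set.Icc a b) (hz : z ∈ Set.Icc a b)
    (hxy : x ≠ y) (hxz : x ≠ z) :
    |slope w x y - slope w x z| ≤ H * (b - a) ^ α := by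
  rcases lt_trichotomy y z with h | rfl | h
  · exact abs_slope_sub_slope_le_of_lt hw hκ hα hH ha hbr hba hx hy hz hxy hxz h
  · have : a ≤ b := hx.1.trans hx.2
    have : 0 ≤ b - a := by linarith
    simp only [sub_self, abs_zero]
    positivity
  · rw [abs_sub_comm]
    exact abs_slope_sub_slope_le_of_lt hw hκ hα hH ha hbr hba hx hz hy hxz hxy h

/-- On an interval of radius η about `x`, the slopes issuing from `x` differ by at most H(2η)^α, so
they form a Cauchy filter. -/
theorem exists_hasDerivAt_of_slope (hw : ∀ a c b, 0 < a → a < c → c < b → b < r →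
      b ≤ (1 + κ) * a → |slope w c b - slope w a c| ≤ H * (b - a) ^ α) (hκ : 0 < κ) (hα : 0 < α)
    (hH : 0 ≤ H) {x : ℝ} (hx : x ∈ Set.Ioo 0 r) : ∃ l, HasDerivAt w l x := by
  have hcauchy : Cauchy (map (slope w x) (𝓝[≠] x)) := by
    rw [Metric.cauchy_iff]
    refine ⟨inferInstance, fun ε hε => ?_⟩
    have e1 : ∀ᶠ η in 𝓝 (0 : ℝ), 0 < x - η :=
      (by fun_prop : Continuous fun η : ℝ => x - η).continuousAt.eventually_const_lt (by simpa using hx.1)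
    have e2 : ∀ᶠ η in 𝓝 (0 : ℝ), x + η < r :=
      (by fun_prop : Continuous fun η : ℝ => x + η).continuousAt.eventually_lt_const (by simpa using hx.2)
    have e3 : ∀ᶠ η in 𝓝 (0 : ℝ), 0 < (1 + κ) * (x - η) - (x + η) :=
      (by fun_prop : Continuous fun η : ℝ => (1 + κ) * (x - η) - (x + η)).continuousAt.eventually_const_lt
        (by have := mul_pos hκ hx.1
            simp only [sub_zero, add_zero]
            linarith)
    have e4 : ∀ᶠ η in 𝓝 (0 : ℝ), H * (2 * η) ^ α < ε :=
      ((((continuous_const.mul continuous_id).rpow_const (fun _ => Or.inr hα.le)).const_mul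
        H).continuousAt (x := (0 : ℝ))).eventually_lt_const
          (by simpa [Real.zero_rpow hα.ne'] using hε)
    obtain ⟨η, ⟨⟨⟨⟨h1, h2⟩, h3⟩, h4⟩, hη⟩⟩ :=
      ((((e1.and e2).and e3).and e4).filter_mono nhdsWithin_le_nhds |>.and
        (self_mem_nhdsWithin : Set.Ioi (0 : ℝ) ∈ 𝓝[>] 0)).exists
    have hη0 : (0 : ℝ) < η := hη
    refine ⟨slope w x '' (Set.Icc (x - η) (x + η) ∩ {x}ᶜ), image_mem_map
      (inter_mem (nhdsWithin_le_nhds (Icc_mem_nhds (by linarith) (by linarith)))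
        self_mem_nhdsWithin), ?_⟩
    rintro _ ⟨y, ⟨hy, hyx⟩, rfl⟩ _ ⟨z, ⟨hz, hzx⟩, rfl⟩
    rw [Real.dist_eq]
    refine (abs_slope_sub_slope_le_of_ne hw hκ hα hH h1 h2 (by linarith)
      ⟨by linarith, by linarith⟩ hy hz (Ne.symm hyx) (Ne.symm hzx)).trans_lt ?_
    convert! h4 using 3
    ring
  obtain ⟨l, hl⟩ := CompleteSpace.complete hcauchy
  exact ⟨l, hasDerivAt_iff_tendsto_slope.2 hl⟩

/-- A function of one variable whose slopes on adjacent intervals differ little is `C^{1,α}`. -/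
theorem exists_holder_deriv_of_slope {B : ℝ} (hw : ∀ a c b, 0 < a → a < c → c < b → b < r →
      b ≤ (1 + κ) * a → |slope w c b - slope w a c| ≤ H * (b - a) ^ α) (hκ : 0 < κ) (hα : 0 < α)
    (hH : 0 ≤ H) (hB : 0 ≤ B) (hwB : ∀ c b, 0 < c → c < b → b < r → b ≤ (1 + κ) * c →
      |slope w c b| ≤ B * c ^ α) :
    ∃ w' : ℝ → ℝ, (∀ t ∈ Set.Ioo 0 r, HasDerivAt w (w' t) t) ∧
      (∀ t ∈ Set.Ioo 0 r, |w' t| ≤ B * t ^ α) ∧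
      ∀ a ∈ Set.Ioo 0 r, ∀ b ∈ Set.Ioo 0 r, a < b →
        |w' a - w' b| ≤ (2 * H + 2 * B * ((1 + κ) / κ) ^ α) * (b - a) ^ α := by
  have hex : ∀ x, ∃ l, x ∈ Set.Ioo 0 r → HasDerivAt w l x := by
    intro x
    by_cases hx : x ∈ Set.Ioo 0 r
    · obtain ⟨l, hl⟩ := exists_hasDerivAt_of_slope hw hκ hα hH hx
      exact ⟨l, fun _ => hl⟩
    · exact ⟨0, fun h => absurd h hx⟩
  choose w' hw' using hex
  have hright : ∀ t ∈ Set.Ioo 0 r, Tendsto (slope w t) (𝓝[>] t) (𝓝 (w' t)) := fun t ht =>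
    (hasDerivAt_iff_tendsto_slope.1 (hw' t ht)).mono_left
      (nhdsWithin_mono t fun _ hx => ne_of_gt hx)
  have hleft : ∀ t ∈ Set.Ioo 0 r, Tendsto (slope w t) (𝓝[<] t) (𝓝 (w' t)) := fun t ht =>
    (hasDerivAt_iff_tendsto_slope.1 (hw' t ht)).mono_left
      (nhdsWithin_mono t fun _ hx => ne_of_lt hx)
  have hbound : ∀ t ∈ Set.Ioo 0 r, |w' t| ≤ B * t ^ α := by
    intro t ht
    refine le_of_tendsto (hright t ht).abs ?_
    have h1 : t < min r ((1 + κ) * t) := lt_min ht.2 (by nlinarith [ht.1])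
    filter_upwards [Ioo_mem_nhdsGT h1] with z hz
    exact hwB t z ht.1 hz.1 (hz.2.trans_le (min_le_left _ _)) (hz.2.le.trans (min_le_right _ _))
  refine ⟨w', hw', hbound, fun a ha b hb hab => ?_⟩
  have hba0 : 0 < b - a := by linarith
  -- Nearby points: both derivatives are compared with the chord joining the points. Distant points:
  -- b is at most (1+κ)/κ times b - a, so the bound Bt^α at each point suffices.
  rcases le_or_gt b ((1 + κ) * a) with hle | hgt
  · have haI : a ∈ Set.Icc a b := ⟨le_rfl, hab.le⟩
    have hbI : b ∈ Set.Icc a b := ⟨hab.le, le_rfl⟩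
    have h1 : |w' a - slope w a b| ≤ H * (b - a) ^ α := by
      refine le_of_tendsto ((hright a ha).sub_const _).abs ?_
      filter_upwards [Ioo_mem_nhdsGT hab] with z hz
      exact abs_slope_sub_slope_le_of_ne hw hκ hα hH ha.1 hb.2 hle haI ⟨hz.1.le, hz.2.le⟩ hbI
        hz.1.ne hab.ne
    have h2 : |w' b - slope w b a| ≤ H * (b - a) ^ α := by
      refine le_of_tendsto ((hleft b hb).sub_const _).abs ?_
      filter_upwards [Ioo_mem_nhdsLT hab] with z hz
      exact abs_slope_sub_slope_le_of_ne hw hκ hα hH ha.1 hb.2 hle hbI ⟨hz.1.le, hz.2.le⟩ haI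
        hz.2.ne' hab.ne'
    rw [slope_comm, abs_sub_comm] at h2
    have h3 := abs_sub_le (w' a) (slope w a b) (w' b)
    have h4 : 0 ≤ 2 * B * ((1 + κ) / κ) ^ α * (b - a) ^ α := by positivity
    linarith
  · have h1 := hbound a ha
    have h2 := hbound b hb
    have h3 : a ^ α ≤ b ^ α := Real.rpow_le_rpow ha.1.le hab.le hα.le
    have h4 : b ^ α ≤ ((1 + κ) / κ) ^ α * (b - a) ^ α := by
      rw [← Real.mul_rpow (by positivity) hba0.le]
      refine Real.rpow_le_rpow hb.1.le ?_ hα.le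
      rw [div_mul_eq_mul_div, le_div_iff₀ hκ]
      linarith
    have h5 := abs_sub (w' a) (w' b)
    have h6 := mul_le_mul_of_nonneg_left h3 hB
    have h7 := mul_le_mul_of_nonneg_left h4 hB
    have h8 : 0 ≤ H * (b - a) ^ α := by positivity
    linarith

end holder

/-! ### Hölder continuity of radial vector fields -/

/-- The angular difference is bounded both by 2 and by 2|x - y|/|x|. The first bound serves when |x|
≤ |x - y|; otherwise the second is weakened to exponent α, using that t^(α-1) is nonincreasing. -/
theorem norm_smul_unit_sub_le {E : Type*} [NormedAddCommGroup E] [NormedSpace ℝ E]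
    {x y : E} {α : ℝ} (hα0 : 0 < α) (hα1 : α ≤ 1) (hx : x ≠ 0) (hy : y ≠ 0) (hxy : ‖x‖ ≤ ‖y‖) :
    ‖x‖ ^ α * ‖‖x‖⁻¹ • x - ‖y‖⁻¹ • y‖ ≤ 2 * ‖x - y‖ ^ α := by
  have hx0 := norm_pos_iff.2 hx
  have hy0 := norm_pos_iff.2 hy
  have hnx : ‖‖x‖⁻¹ • x‖ = 1 := by rw [norm_smul, norm_inv, norm_norm, inv_mul_cancel₀ hx0.ne']
  have hny : ‖‖y‖⁻¹ • y‖ = 1 := by rw [norm_smul, norm_inv, norm_norm, inv_mul_cancel₀ hy0.ne']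
  rcases le_or_gt ‖x‖ ‖x - y‖ with h | h
  · have h1 := norm_sub_le (‖x‖⁻¹ • x) (‖y‖⁻¹ • y)
    rw [hnx, hny] at h1
    rw [mul_comm]
    exact mul_le_mul (by linarith) (Real.rpow_le_rpow hx0.le h hα0.le) (by positivity) (by norm_num)
  · rcases eq_or_ne x y with rfl | hne
    · simp [Real.zero_rpow hα0.ne']
    have hd0 : 0 < ‖x - y‖ := norm_pos_iff.2 (sub_ne_zero.2 hne)
    have h1 : ‖x‖ * ‖‖x‖⁻¹ • x - ‖y‖⁻¹ • y‖ ≤ 2 * ‖x - y‖ := by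
      have h2 : ‖x‖ * ‖‖x‖⁻¹ • x - ‖y‖⁻¹ • y‖ = ‖(x - y) + (‖y‖ - ‖x‖) • (‖y‖⁻¹ • y)‖ := by
        rw [← norm_norm x, ← norm_smul, norm_norm, smul_sub, smul_smul, mul_inv_cancel₀ hx0.ne',
          one_smul, sub_smul (‖y‖), smul_smul (‖y‖), mul_inv_cancel₀ hy0.ne', one_smul]
        congr 1
        abel
      rw [h2]
      refine (norm_add_le _ _).trans ?_
      rw [norm_smul, hny, mul_one, Real.norm_of_nonneg (by linarith)]
      have := norm_sub_norm_le y x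
      rw [norm_sub_rev] at this
      linarith
    have h3 : ‖x‖ ^ α / ‖x‖ ≤ ‖x - y‖ ^ α / ‖x - y‖ := by
      rw [← Real.rpow_sub_one hx0.ne', ← Real.rpow_sub_one hd0.ne']
      exact Real.rpow_le_rpow_of_nonpos hd0 h.le (by linarith)
    calc ‖x‖ ^ α * ‖‖x‖⁻¹ • x - ‖y‖⁻¹ • y‖
        = ‖x‖ ^ α / ‖x‖ * (‖x‖ * ‖‖x‖⁻¹ • x - ‖y‖⁻¹ • y‖) := by field_simp
      _ ≤ ‖x - y‖ ^ α / ‖x - y‖ * (2 * ‖x - y‖) := mul_le_mul h3 h1 (by positivity) (by positivity)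
      _ = 2 * ‖x - y‖ ^ α := by field_simp

/-- A radial vector field with Hölder continuous profile is Hölder continuous. -/
theorem norm_radial_field_sub_le {E : Type*} [NormedAddCommGroup E] [NormedSpace ℝ E]
    {f : ℝ → ℝ} {α B L r : ℝ} (hα0 : 0 < α) (hα1 : α ≤ 1) (hB : 0 ≤ B) (hL : 0 ≤ L)
    (hfB : ∀ t ∈ Set.Ioo 0 r, |f t| ≤ B * t ^ α)
    (hfL : ∀ a ∈ Set.Ioo 0 r, ∀ b ∈ Set.Ioo 0 r, a < b → |f a - f b| ≤ L * (b - a) ^ α)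
    {x y : E} (hx : ‖x‖ < r) (hy : ‖y‖ < r) :
    ‖(f ‖x‖ / ‖x‖) • x - (f ‖y‖ / ‖y‖) • y‖ ≤ (2 * B + L) * ‖x - y‖ ^ α := by
  wlog hxy : ‖x‖ ≤ ‖y‖ generalizing x y
  · rw [norm_sub_rev, norm_sub_rev x y]
    exact this hy hx (le_of_not_ge hxy)
  rcases eq_or_ne y 0 with rfl | hy0
  · have : x = 0 := by simpa using hxy
    subst this
    simp only [sub_self, norm_zero]
    positivity
  have hyp := norm_pos_iff.2 hy0
  have hny : ‖‖y‖⁻¹ • y‖ = 1 := by rw [norm_smul, norm_inv, norm_norm, inv_mul_cancel₀ hyp.ne']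
  rcases eq_or_ne x 0 with rfl | hx0
  · rw [smul_zero, zero_sub, norm_neg, zero_sub, norm_neg, div_eq_mul_inv, mul_smul, norm_smul,
      hny, mul_one, Real.norm_eq_abs]
    refine (hfB _ ⟨hyp, hy⟩).trans (mul_le_mul_of_nonneg_right (by linarith) (by positivity))
  have hxp := norm_pos_iff.2 hx0
  -- Split into a change of direction, weighted by the profile at the point nearer to the origin,
  -- and a change of profile.
  have e : (f ‖x‖ / ‖x‖) • x - (f ‖y‖ / ‖y‖) • y =
      f ‖x‖ • (‖x‖⁻¹ • x - ‖y‖⁻¹ • y) + (f ‖x‖ - f ‖y‖) • (‖y‖⁻¹ • y) := by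
    rw [div_eq_mul_inv, div_eq_mul_inv, mul_smul, mul_smul, smul_sub, sub_smul]
    abel
  have h1 : ‖f ‖x‖ • (‖x‖⁻¹ • x - ‖y‖⁻¹ • y)‖ ≤ 2 * B * ‖x - y‖ ^ α := by
    rw [norm_smul, Real.norm_eq_abs]
    have := mul_le_mul_of_nonneg_left (norm_smul_unit_sub_le hα0 hα1 hx0 hy0 hxy) hB
    have := mul_le_mul_of_nonneg_right (hfB _ ⟨hxp, hx⟩)
      (norm_nonneg (‖x‖⁻¹ • x - ‖y‖⁻¹ • y))
    linarith
  have h2 : ‖(f ‖x‖ - f ‖y‖) • (‖y‖⁻¹ • y)‖ ≤ L * ‖x - y‖ ^ α := by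
    rw [norm_smul, hny, mul_one, Real.norm_eq_abs]
    rcases hxy.lt_or_eq with hlt | heq
    · refine (hfL _ ⟨hxp, hx⟩ _ ⟨hyp, hy⟩ hlt).trans (mul_le_mul_of_nonneg_left ?_ hL)
      refine Real.rpow_le_rpow (by linarith) ?_ hα0.le
      rw [norm_sub_rev]
      exact norm_sub_norm_le y x
    · rw [heq, sub_self, abs_zero]
      positivity
  rw [e]
  refine (norm_add_le _ _).trans ?_
  linarith

/-! ### Local Hölder classes -/

section HolderLoc

variable {d : ℕ} {α : ℝ} {u : EuclideanSpace ℝ (Fin d) → ℝ} {U : Set (EuclideanSpace ℝ (Fin d))}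

theorem norm_gradient_sub (u : EuclideanSpace ℝ (Fin d) → ℝ) (x y : EuclideanSpace ℝ (Fin d)) :
    ‖gradient u x - gradient u y‖ = ‖fderiv ℝ u x - fderiv ℝ u y‖ := by
  rw [gradient, gradient, ← map_sub, LinearIsometryEquiv.norm_map]

theorem isC1HolderLoc_of_hasFDerivAt {D : EuclideanSpace ℝ (Fin d) → EuclideanSpace ℝ (Fin d) →L[ℝ] ℝ}
    {L : ℝ} (hα : 0 < α) (hU : IsOpen U) (hD : ∀ x ∈ U, HasFDerivAt u (D x) x)
    (hL : ∀ x ∈ U, ∀ y ∈ U, ‖D x - D y‖ ≤ L * ‖x - y‖ ^ α) : IsC1HolderLoc α u U := by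
  have hDc : ContinuousOn D U := by
    intro x hx
    refine tendsto_iff_norm_sub_tendsto_zero.2 ?_
    have h1 : Tendsto (fun y => L * ‖y - x‖ ^ α) (𝓝[U] x) (𝓝 0) := by
      have : Continuous fun y : EuclideanSpace ℝ (Fin d) => L * ‖y - x‖ ^ α :=
        continuous_const.mul ((by fun_prop : Continuous fun y : EuclideanSpace ℝ (Fin d) =>
          ‖y - x‖).rpow_const fun _ => Or.inr hα.le)
      have h2 := (this.tendsto x).mono_left (nhdsWithin_le_nhds (s := U))
      simpa [Real.zero_rpow hα.ne'] using h2
    refine squeeze_zero' (Eventually.of_forall fun _ => norm_nonneg _) ?_ h1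
    filter_upwards [self_mem_nhdsWithin] with y hy using hL y hy x hx
  refine ⟨?_, fun K hK _ => ⟨L, fun x hx y hy => ?_⟩⟩
  · rw [show (1 : WithTop ℕ∞) = 0 + 1 from rfl, contDiffOn_succ_iff_fderiv_of_isOpen hU]
    refine ⟨fun x hx => (hD x hx).differentiableAt.differentiableWithinAt, by simp, ?_⟩
    rw [contDiffOn_zero]
    exact hDc.congr fun x hx => (hD x hx).fderiv
  · rw [norm_gradient_sub, (hD x (hK hx)).fderiv, (hD y (hK hy)).fderiv]
    exact hL x (hK hx) y (hK hy)

/-- Compactness is applied to K × K: near the diagonal the local Hölder bound applies, and away from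
it |x - y|^α is bounded below while the gradients are locally bounded. -/
theorem isC1HolderLoc_of_locally (hα : 0 < α)
    (h : ∀ x ∈ U, ∃ r : ℝ, 0 < r ∧ IsC1HolderLoc α u (ball x r)) : IsC1HolderLoc α u U := by
  have hat : ∀ x ∈ U, ContDiffAt ℝ 1 u x := fun x hx => by
    obtain ⟨r, hr, hu, -⟩ := h x hx
    exact hu.contDiffAt (ball_mem_nhds x hr)
  refine ⟨fun x hx => (hat x hx).contDiffWithinAt, fun K hK hKc => ?_⟩
  suffices H : ∃ L : ℝ, ∀ z ∈ K ×ˢ K, ‖gradient u z.1 - gradient u z.2‖ ≤ L * ‖z.1 - z.2‖ ^ α by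
    obtain ⟨L, hL⟩ := H
    exact ⟨L, fun x hx y hy => hL (x, y) ⟨hx, hy⟩⟩
  refine (hKc.prod hKc).induction_on (p := fun S => ∃ L : ℝ, ∀ z ∈ S,
    ‖gradient u z.1 - gradient u z.2‖ ≤ L * ‖z.1 - z.2‖ ^ α) ⟨0, by simp⟩ ?_ ?_ ?_
  · rintro s t hst ⟨L, hL⟩
    exact ⟨L, fun z hz => hL z (hst hz)⟩
  · rintro s t ⟨L₁, h₁⟩ ⟨L₂, h₂⟩
    refine ⟨max L₁ L₂, ?_⟩
    rintro z (hz | hz)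
    · exact (h₁ z hz).trans (mul_le_mul_of_nonneg_right (le_max_left _ _) (by positivity))
    · exact (h₂ z hz).trans (mul_le_mul_of_nonneg_right (le_max_right _ _) (by positivity))
  · rintro ⟨x, y⟩ ⟨hx, hy⟩
    rcases eq_or_ne x y with rfl | hne
    · obtain ⟨r, hr, -, hH⟩ := h x (hK hx)
      obtain ⟨L, hL⟩ := hH (closedBall x (r / 2)) (closedBall_subset_ball (by linarith))
        (isCompact_closedBall _ _)
      have hn := closedBall_mem_nhds x (half_pos hr)
      exact ⟨closedBall x (r / 2) ×ˢ closedBall x (r / 2),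
        nhdsWithin_le_nhds (prod_mem_nhds hn hn), L, fun z hz => hL z.1 hz.1 z.2 hz.2⟩
    · have hcx : ContinuousAt (fderiv ℝ u) x :=
        ((hat x (hK hx)).fderiv_right (m := 0) (by norm_num)).continuousAt
      have hcy : ContinuousAt (fderiv ℝ u) y :=
        ((hat y (hK hy)).fderiv_right (m := 0) (by norm_num)).continuousAt
      have hc : ContinuousAt (fun z : EuclideanSpace ℝ (Fin d) × EuclideanSpace ℝ (Fin d) =>
          ‖fderiv ℝ u z.1 - fderiv ℝ u z.2‖) (x, y) :=
        ((hcx.comp (f := Prod.fst) (x := (x, y)) continuousAt_fst).sub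
          (hcy.comp (f := Prod.snd) (x := (x, y)) continuousAt_snd)).norm
      have hd : ContinuousAt (fun z : EuclideanSpace ℝ (Fin d) × EuclideanSpace ℝ (Fin d) =>
          ‖z.1 - z.2‖ ^ α) (x, y) :=
        ((by fun_prop : Continuous fun z : EuclideanSpace ℝ (Fin d) × EuclideanSpace ℝ (Fin d) =>
          ‖z.1 - z.2‖).rpow_const fun _ => Or.inr hα.le).continuousAt
      have hpos : 0 < ‖x - y‖ ^ α :=
        Real.rpow_pos_of_pos (norm_pos_iff.2 (sub_ne_zero.2 hne)) α
      set A := ‖fderiv ℝ u x - fderiv ℝ u y‖ + 1 with hA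
      have hA0 : 0 < A := by positivity
      set δ := ‖x - y‖ ^ α / 2 with hδ
      have hδ0 : 0 < δ := by positivity
      have e1 := hc.eventually_lt_const (u := A) (by simp [hA])
      have e2 := hd.eventually_const_lt (u := δ) (by simpa [hδ] using hpos)
      refine ⟨_, nhdsWithin_le_nhds (e1.and e2), A / δ, fun z hz => ?_⟩
      rw [norm_gradient_sub]
      refine hz.1.le.trans ?_
      rw [div_mul_eq_mul_div, le_div_iff₀ hδ0]
      exact mul_le_mul_of_nonneg_left hz.2.le hA0.le

theorem ContDiffAt.exists_isC1HolderLoc (hα0 : 0 < α) (hα1 : α ≤ 1) {x : EuclideanSpace ℝ (Fin d)}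
    (hu : ContDiffAt ℝ 2 u x) : ∃ r : ℝ, 0 < r ∧ IsC1HolderLoc α u (ball x r) := by
  obtain ⟨K, t, ht, hK⟩ := (hu.fderiv_right (m := 1) (by norm_num)).exists_lipschitzOnWith
  obtain ⟨r, hr, hsub⟩ := Metric.mem_nhds_iff.1 (inter_mem ht (hu.eventually (by simp)))
  refine ⟨min r (1 / 2), by positivity, isC1HolderLoc_of_hasFDerivAt (D := fderiv ℝ u) (L := K) hα0 isOpen_ball
    (fun y hy => ?_) fun y hy z hz => ?_⟩
  · have h1 : ContDiffAt ℝ 2 u y := by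
      simpa using (hsub (ball_subset_ball (min_le_left _ _) hy)).2
    exact (h1.differentiableAt (by norm_num)).hasFDerivAt
  · have h1 := hK.dist_le_mul y (hsub (ball_subset_ball (min_le_left _ _) hy)).1 z
      (hsub (ball_subset_ball (min_le_left _ _) hz)).1
    rw [dist_eq_norm, dist_eq_norm] at h1
    refine h1.trans (mul_le_mul_of_nonneg_left ?_ K.2)
    have h2 : ‖y - z‖ ≤ 1 := by
      rw [← dist_eq_norm]
      have := dist_triangle_right y z x
      have h3 := (mem_ball.1 hy).trans_le (min_le_right _ _)
      have h4 := (mem_ball.1 hz).trans_le (min_le_right _ _)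
      linarith
    exact Real.self_le_rpow_of_le_one (norm_nonneg _) h2 hα1

end HolderLoc

/-! ### Regularity across the centre and conclusion -/

namespace RadialPerturbation

variable {d : ℕ} {p C M r : ℝ} {u φ : EuclideanSpace ℝ (Fin d) → ℝ} {ψ : ℝ → ℝ}
  {X₀ : EuclideanSpace ℝ (Fin d)}

theorem norm_fderiv_sub_le (h : RadialPerturbation p C M r u φ ψ X₀)
    {x y : EuclideanSpace ℝ (Fin d)} (hx : x ∈ ball X₀ r) (hy : y ∈ ball X₀ r) :
    ‖fderiv ℝ φ x - fderiv ℝ φ y‖ ≤ M * ‖x - y‖ :=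
  (convex_ball X₀ r).norm_image_sub_le_of_norm_fderiv_le (𝕜 := ℝ)
    (fun _ hz => (h.hasFDerivAt_fderiv hz).differentiableAt) h.hess_le hy hx

theorem exists_radial_deriv (h : RadialPerturbation p C M r u φ ψ X₀)
    {e : EuclideanSpace ℝ (Fin d)} (he : ‖e‖ = 1) :
    ∃ (ψ' : ℝ → ℝ) (B L : ℝ), 0 ≤ B ∧ 0 ≤ L ∧ (∀ t ∈ Set.Ioo 0 r, HasDerivAt ψ (ψ' t) t) ∧
      (∀ t ∈ Set.Ioo 0 r, |ψ' t| ≤ B * t ^ (1 / (p - 1))) ∧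
      ∀ a ∈ Set.Ioo 0 r, ∀ b ∈ Set.Ioo 0 r, a < b →
        |ψ' a - ψ' b| ≤ L * (b - a) ^ (1 / (p - 1)) := by
  have hp := h.two_le
  have hM := h.M_nonneg
  have hκ := h.ratioConst_pos
  have hH := h.holderConst_pos
  have hΛ := h.slopeConst_pos
  set α := 1 / (p - 1) with hα
  have hα0 : 0 < α := by rw [hα]; apply one_div_pos.2; linarith
  have hα1 : α ≤ 1 := by rw [hα, div_le_one (by linarith)]; linarith
  have hpow : ∀ t, 0 < t → t < r → t ≤ t ^ α := fun t ht htr => by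
    simpa using Real.rpow_le_rpow_of_exponent_ge ht (htr.le.trans h.r_le) hα1
  obtain ⟨w', hw', hwB, hwL⟩ := exists_holder_deriv_of_slope
    (w := fun x : ℝ => u (X₀ + x • e)) (B := 2 * slopeConst d p C M)
    (fun a c b ha hac hcb hbr hba => h.abs_slope_sub_slope_le he ha hac hcb hbr hba)
    hκ hα0 hH.le (by positivity) (fun c b hc hcb hbr hbc => by
      have h1 := h.abs_slope_le he hc hcb hbr hbc
      rw [slope_def_field, abs_div, abs_of_pos (by linarith : 0 < b - c),
        div_le_iff₀ (by linarith)]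
      exact h1)
  refine ⟨fun t => w' t - fderiv ℝ φ (X₀ + t • e) e, 2 * slopeConst d p C M + M,
    2 * holderConst d p C M + 2 * (2 * slopeConst d p C M) *
      ((1 + ratioConst d p) / ratioConst d p) ^ (1 / (p - 1)) + M,
    by positivity, by positivity, fun t ht => ?_, fun t ht => ?_, fun a ha b hb hab => ?_⟩
  · refine ((hw' t ht).sub (h.hasDerivAt_ray he ht.1.le ht.2)).congr_of_eventuallyEq ?_
    filter_upwards [Ioo_mem_nhds ht.1 ht.2] with x hx
    have h2 := h.eq _ (add_smul_mem (X₀ := X₀) he hx.1.le hx.2)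
    rw [add_sub_cancel_left, norm_smul, he, mul_one, Real.norm_of_nonneg hx.1.le] at h2
    simp [h2]
  · have hmem := add_smul_mem (X₀ := X₀) he ht.1.le ht.2
    have h1 := (fderiv ℝ φ (X₀ + t • e)).le_opNorm e
    have h2 := h.fderiv_le _ hmem
    rw [add_sub_cancel_left, norm_smul, he, mul_one, Real.norm_of_nonneg ht.1.le] at h2
    rw [he, mul_one, Real.norm_eq_abs] at h1
    have h3 := abs_sub (w' t) (fderiv ℝ φ (X₀ + t • e) e)
    have h4 := mul_le_mul_of_nonneg_left (hpow t ht.1 ht.2) hM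
    have h5 := hwB t ht
    linarith
  · have h1 := (fderiv ℝ φ (X₀ + a • e) - fderiv ℝ φ (X₀ + b • e)).le_opNorm e
    have h2 := h.norm_fderiv_sub_le (add_smul_mem (X₀ := X₀) he ha.1.le ha.2)
      (add_smul_mem (X₀ := X₀) he hb.1.le hb.2)
    rw [add_sub_add_left_eq_sub, ← sub_smul, norm_smul, he, mul_one, Real.norm_eq_abs,
      abs_sub_comm, abs_of_pos (by linarith : 0 < b - a)] at h2
    rw [he, mul_one, Real.norm_eq_abs, sub_apply] at h1
    have h4 := mul_le_mul_of_nonneg_left (hpow (b - a) (by linarith) (by linarith [ha.1, hb.2])) hM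
    have h5 := hwL a ha b hb hab
    have h6 := abs_sub (w' a - w' b)
      (fderiv ℝ φ (X₀ + a • e) e - fderiv ℝ φ (X₀ + b • e) e)
    rw [add_mul]
    have h7 : w' a - fderiv ℝ φ (X₀ + a • e) e - (w' b - fderiv ℝ φ (X₀ + b • e) e) =
      w' a - w' b - (fderiv ℝ φ (X₀ + a • e) e - fderiv ℝ φ (X₀ + b • e) e) := by ring
    rw [h7]
    linarith

/-- The growth exponent 1 + α exceeds 1, so the radial part is o(|X - X₀|) after subtracting `ψ 0`.
-/
theorem hasFDerivAt_radial_center (h : RadialPerturbation p C M r u φ ψ X₀)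
    {e : EuclideanSpace ℝ (Fin d)} (he : ‖e‖ = 1) :
    HasFDerivAt (fun X => ψ ‖X - X₀‖) (0 : EuclideanSpace ℝ (Fin d) →L[ℝ] ℝ) X₀ := by
  have hp := h.two_le
  have hK := h.growthConst_nonneg
  have hα0 : 0 < 1 / (p - 1) := one_div_pos.2 (by linarith)
  rw [hasFDerivAt_iff_isLittleO, Asymptotics.isLittleO_iff]
  intro c hc
  have h1 : Continuous fun X : EuclideanSpace ℝ (Fin d) =>
      growthConst d p C M * ‖X - X₀‖ ^ (1 / (p - 1)) :=
    continuous_const.mul ((by fun_prop : Continuous fun X : EuclideanSpace ℝ (Fin d) =>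
      ‖X - X₀‖).rpow_const fun _ => Or.inr hα0.le)
  have h2 := (h1.tendsto X₀).eventually_lt_const (u := c)
    (by rw [sub_self, norm_zero, Real.zero_rpow hα0.ne', mul_zero]; exact hc)
  filter_upwards [h2, ball_mem_nhds X₀ h.r_pos] with X hX hXb
  rcases eq_or_ne X X₀ with rfl | hne
  · simp
  have hpos : 0 < ‖X - X₀‖ := norm_pos_iff.2 (sub_ne_zero.2 hne)
  have h3 := h.abs_radial_growth he hpos (by simpa [dist_eq_norm] using hXb)
  rw [Real.rpow_add hpos, Real.rpow_one] at h3
  simp only [sub_self, norm_zero, zero_apply, sub_zero, Real.norm_eq_abs]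
  have h4 := mul_le_mul_of_nonneg_right hX.le hpos.le
  linarith

/-- Radial perturbations with bounded `p`-Laplacian are `C^{1,1/(p-1)}`. -/
theorem isC1HolderLoc (h : RadialPerturbation p C M r u φ ψ X₀)
    {e : EuclideanSpace ℝ (Fin d)} (he : ‖e‖ = 1) :
    IsC1HolderLoc (1 / (p - 1)) u (ball X₀ (r / 2)) := by
  have hp := h.two_le
  have hα0 : 0 < 1 / (p - 1) := one_div_pos.2 (by linarith)
  have hα1 : 1 / (p - 1) ≤ 1 := by rw [div_le_one (by linarith)]; linarith
  have hr := h.r_pos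
  obtain ⟨ψ', B, L, hB, hL, hψ, hψB, hψL⟩ := h.exists_radial_deriv he
  have hsub : ball X₀ (r / 2) ⊆ ball X₀ r := ball_subset_ball (by linarith)
  refine isC1HolderLoc_of_hasFDerivAt (L := M + (2 * B + L)) hα0 isOpen_ball
    -- At the centre the quotient is a division by zero, but it multiplies the zero vector, so the
    -- formula gives the correct radial derivative 0.
    (D := fun X => fderiv ℝ φ X + innerSL ℝ ((ψ' ‖X - X₀‖ / ‖X - X₀‖) • (X - X₀)))
    (fun X hX => ?_) fun X hX Y hY => ?_
  · have hXb := hsub hX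
    have h1 : HasFDerivAt (fun X => ψ ‖X - X₀‖)
        (innerSL ℝ ((ψ' ‖X - X₀‖ / ‖X - X₀‖) • (X - X₀))) X := by
      rcases eq_or_ne X X₀ with rfl | hne
      · simpa using h.hasFDerivAt_radial_center he
      · have hpos : 0 < ‖X - X₀‖ := norm_pos_iff.2 (sub_ne_zero.2 hne)
        refine ((hψ _ ⟨hpos, by simpa [dist_eq_norm] using hXb⟩).hasFDerivAt_comp_norm_sub
          hne).congr_fderiv ?_
        rw [map_smul]
    refine ((h.hasFDerivAt hXb).add h1).congr_of_eventuallyEq ?_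
    filter_upwards [isOpen_ball.mem_nhds hXb] with Z hZ using h.eq Z hZ
  · have h1 := h.norm_fderiv_sub_le (hsub hX) (hsub hY)
    have hX' : ‖X - X₀‖ < r / 2 := by simpa [dist_eq_norm] using hX
    have hY' : ‖Y - X₀‖ < r / 2 := by simpa [dist_eq_norm] using hY
    have h2 := norm_radial_field_sub_le hα0 hα1 hB hL hψB hψL (x := X - X₀) (y := Y - X₀)
      (by linarith) (by linarith)
    rw [sub_sub_sub_cancel_right] at h2
    have h3 : ‖X - Y‖ ≤ ‖X - Y‖ ^ (1 / (p - 1)) := by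
      have : ‖X - Y‖ ≤ 1 := by
        have := norm_sub_le (X - X₀) (Y - X₀)
        rw [sub_sub_sub_cancel_right] at this
        linarith [h.r_le]
      exact Real.self_le_rpow_of_le_one (norm_nonneg _) this hα1
    have h4 := mul_le_mul_of_nonneg_left h3 h.M_nonneg
    rw [add_sub_add_comm, ← map_sub]
    refine (norm_add_le _ _).trans ?_
    rw [innerSL_apply_norm]
    linarith

end RadialPerturbation

/-- The O(|X - X₀|²) condition makes φ and its differential vanish at the centre. The differential
is Lipschitz near there because φ is C², which supplies `M`. Weakening `C` to `max C 0` makes the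
bound nonnegative. -/
theorem SmoothUpToRadialSingularityAt.exists_radialPerturbation {d : ℕ} {p C : ℝ} (hp : 2 ≤ p)
    {u : EuclideanSpace ℝ (Fin d) → ℝ} {U : Set (EuclideanSpace ℝ (Fin d))} (hU : IsOpen U)
    (hu : ViscosityPLaplacianBounded p C u U) {X₀ : EuclideanSpace ℝ (Fin d)} (hX₀ : X₀ ∈ U)
    (h : SmoothUpToRadialSingularityAt u X₀) :
    ∃ M r φ ψ, ball X₀ r ⊆ U ∧ RadialPerturbation p (max C 0) M r u φ ψ X₀ := by
  obtain ⟨r₀, hr₀, φ, ψ, hφ, hφO, hueq⟩ := h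
  have hφat : ContDiffAt ℝ 2 φ X₀ := hφ.contDiffAt (ball_mem_nhds X₀ hr₀)
  obtain ⟨M, t, ht, hlip⟩ := (hφat.fderiv_right (m := 1) (by norm_num)).exists_lipschitzOnWith
  obtain ⟨r₁, hr₁, hsub⟩ := Metric.mem_nhds_iff.1
    (inter_mem (inter_mem (ball_mem_nhds X₀ hr₀) (hU.mem_nhds hX₀)) ht)
  set r := min r₁ 1 with hr
  have hrr : ball X₀ r ⊆ ball X₀ r₁ := ball_subset_ball (min_le_left _ _)
  have hr0 : 0 < r := by positivity
  have hφ0 : fderiv ℝ φ X₀ = 0 := (hφO.hasFDerivAt (by norm_num)).fderiv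
  have hbU : ball X₀ r ⊆ U := fun x hx => (hsub (hrr hx)).1.2
  have hb0 : ball X₀ r ⊆ ball X₀ r₀ := fun x hx => (hsub (hrr hx)).1.1
  have hess : ∀ x ∈ ball X₀ r, ‖fderiv ℝ (fderiv ℝ φ) x‖ ≤ M := fun x hx =>
    norm_fderiv_le_of_lipschitzOn ℝ (isOpen_ball.mem_nhds hx)
      (hlip.mono fun y hy => (hsub (hrr hy)).2)
  refine ⟨M, r, φ, ψ, hbU, ?_⟩
  exact
    { two_le := hp
      C_nonneg := le_max_right _ _
      M_nonneg := M.2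
      r_pos := hr0
      r_le := min_le_right _ _
      contDiffOn := hφ.mono hb0
      map_center := hφO.eq_zero_of_norm_pow (by norm_num)
      fderiv_le := fun x hx => by
        have := (convex_ball X₀ r).norm_image_sub_le_of_norm_fderiv_le (𝕜 := ℝ)
          (f := fderiv ℝ φ) (fun z hz => (((hφ.contDiffAt (isOpen_ball.mem_nhds
            (hb0 hz))).fderiv_right (m := 1) (by norm_num)).differentiableAt (by norm_num)))
          hess (mem_ball_self hr0) hx
        simpa [hφ0] using this
      hess_le := hess
      eq := fun x hx => hueq x (hb0 hx)
      continuousOn := hu.1.mono hbU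
      below := fun Y hY f hf ht => (hu.2.1 Y (hbU hY) f hf ht).trans (le_max_left _ _)
      above := fun Y hY f hf ht => le_trans (neg_le_neg (le_max_left _ _))
        (hu.2.2 Y (hbU hY) f hf ht) }

theorem SmoothUpToRadialSingularityAt.exists_isC1HolderLoc {d : ℕ} {p C : ℝ} (hp : 2 ≤ p)
    {u : EuclideanSpace ℝ (Fin d) → ℝ} {U : Set (EuclideanSpace ℝ (Fin d))} (hU : IsOpen U)
    (hu : ViscosityPLaplacianBounded p C u U) {X₀ : EuclideanSpace ℝ (Fin d)} (hX₀ : X₀ ∈ U)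
    (h : SmoothUpToRadialSingularityAt u X₀) :
    ∃ r : ℝ, 0 < r ∧ ball X₀ r ⊆ U ∧ IsC1HolderLoc (1 / (p - 1)) u (ball X₀ r) := by
  obtain ⟨M, r, φ, ψ, hsub, hpert⟩ := h.exists_radialPerturbation hp hU hu hX₀
  have hr := hpert.r_pos
  refine ⟨r / 2, by positivity, (ball_subset_ball (by linarith)).trans hsub, ?_⟩
  -- In dimension 0 there is no unit vector to define a ray, but everything is trivially
  -- differentiable.
  rcases subsingleton_or_nontrivial (EuclideanSpace ℝ (Fin d)) with hs | hs
  · refine isC1HolderLoc_of_hasFDerivAt (D := 0) (L := 0) (one_div_pos.2 (by linarith))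
      isOpen_ball (fun x _ => hasFDerivAt_of_subsingleton u x) (by simp)
  · obtain ⟨e, he⟩ := exists_norm_eq (EuclideanSpace ℝ (Fin d)) zero_le_one
    exact hpert.isC1HolderLoc he

theorem theorem4p4 (d : ℕ) (p C : ℝ) (hp : 2 ≤ p)
    (u : EuclideanSpace ℝ (Fin d) → ℝ)
    (hu : ViscosityPLaplacianBounded p C u (Metric.ball 0 1)) :
    (∀ X₀ ∈ Metric.ball (0 : EuclideanSpace ℝ (Fin d)) 1, SmoothUpToRadialSingularityAt u X₀ →
      ∃ r : ℝ, 0 < r ∧ Metric.ball X₀ r ⊆ Metric.ball 0 1 ∧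
        IsC1HolderLoc (1 / (p - 1)) u (Metric.ball X₀ r)) ∧
    ((∀ X ∈ Metric.ball (0 : EuclideanSpace ℝ (Fin d)) 1,
        ContDiffAt ℝ 2 u X ∨ SmoothUpToRadialSingularityAt u X) →
      IsC1HolderLoc (1 / (p - 1)) u (Metric.ball 0 1)) := by
  have hα0 : 0 < 1 / (p - 1) := one_div_pos.2 (by linarith)
  have hα1 : 1 / (p - 1) ≤ 1 := by rw [div_le_one (by linarith)]; linarith
  refine ⟨fun X₀ hX₀ h => h.exists_isC1HolderLoc hp isOpen_ball hu hX₀, fun h => ?_⟩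
  refine isC1HolderLoc_of_locally hα0 fun X hX => ?_
  rcases h X hX with h1 | h1
  · exact h1.exists_isC1HolderLoc hα0 hα1
  · obtain ⟨r, hr, -, hH⟩ := h1.exists_isC1HolderLoc hp isOpen_ball hu hX
    exact ⟨r, hr, hH⟩
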